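/- Let $n\ge 2$, let $\omega\subset\mathbb{R}^n$ be a bounded open set of class $C^2$ (not necessarily connected), and let $\delta(x)=\operatorname{dist}(x,\partial\omega)$. Let $1\le p<n$, $a>p-1$ and $k\ge 0$ be real numbers. (i) Set $p^*=np/(n-p)$. There is a constant $C$, depending only on $n,\omega,p,a,k$, such that for all $v\in W^{1,p}(\omega)$ $$\Bigl(\int_\omega \delta^{na/(n-p)}|v|^{p^*}\,dx\Bigr)^{p/p^*}\le C\Bigl(\int_\omega \delta^k|v|\,dx\Bigr)^p+C\int_\omega\delta^a|\nabla v|^p\,dx .$$ (ii) There is a constant $C$, depending only on $n,\omega,p,a,k$, such that for all $v\in W^{1,p}(\omega)$ $$\int_\omega \delta^{a-p}|v|^{p}\,dx\le C\Bigl(\int_\omega \delta^k|v|\,dx\Bigr)^p+C\int_\omega\delta^a|\nabla v|^p\,dx .$$ The right-hand sides are finite for every $v\in W^{1,p}(\omega)$, so in particular the integrals on the left-hand sides are finite. -/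

import Mathlib

open MeasureTheory
open scoped ENNReal NNReal

/-- `ℝⁿ` with its Euclidean norm. -/
abbrev EucSp (n : ℕ) : Type := EuclideanSpace ℝ (Fin n)

/-- The distance to the boundary, `δ(x) = dist(x, ∂ω)`. -/
noncomputable def bdryDist {n : ℕ} (ω : Set (EucSp n)) (x : EucSp n) : ℝ :=
  Metric.infDist x (frontier ω)

/-- `ω` is of class `C²`: near each boundary point, in orthonormal coordinates whose last axis
points along a unit vector `e`, the set `ω` is the part lying strictly above the graph of a `C²`
function `γ` of the remaining coordinates (i.e. of the hyperplane orthogonal to `e`). -/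
def IsClassC2 {n : ℕ} (ω : Set (EucSp n)) : Prop :=
  ∀ x₀ ∈ frontier ω, ∃ (e : EucSp n) (γ : (Submodule.span ℝ {e})ᗮ → ℝ) (r : ℝ),
    ‖e‖ = 1 ∧ ContDiff ℝ 2 γ ∧ 0 < r ∧
      ∀ x ∈ Metric.ball x₀ r,
        (x ∈ ω ↔ γ ((Submodule.span ℝ {e})ᗮ.orthogonalProjectionOnto x) < inner ℝ e x)

/-- `g` is the weak gradient of `v` on `ω`: `∫_ω v ∂ᵢφ = -∫_ω gᵢ φ` for every coordinate `i` and
every smooth `φ` with compact support in `ω`. -/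
def IsWeakGradient {n : ℕ} (ω : Set (EucSp n)) (v : EucSp n → ℝ) (g : EucSp n → EucSp n) : Prop :=
  ∀ φ : EucSp n → ℝ, ContDiff ℝ ((⊤ : ℕ∞) : WithTop ℕ∞) φ → HasCompactSupport φ → tsupport φ ⊆ ω → ∀ i : Fin n,
    ∫ x in ω, v x * fderiv ℝ φ x (EuclideanSpace.single i 1) = -∫ x in ω, g x i * φ x

/-- `v ∈ W^{1,p}(ω)` with (almost everywhere unique) weak gradient `∇v = g`: both `v` and `g` are
in `L^p(ω)`. -/
structure IsSobolevW1 {n : ℕ} (p : ℝ) (ω : Set (EucSp n)) (v : EucSp n → ℝ)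
    (g : EucSp n → EucSp n) : Prop where
  memLp : MemLp v (ENNReal.ofReal p) (volume.restrict ω)
  memLp_grad : MemLp g (ENNReal.ofReal p) (volume.restrict ω)
  isWeakGradient : IsWeakGradient ω v g

/-- The Sobolev exponent `p* = np/(n-p)`. -/
noncomputable def sobolevExp (n : ℕ) (p : ℝ) : ℝ := (n : ℝ) * p / ((n : ℝ) - p)

open Set Metric Filter Topology

/-! Write `d` for the distance to the complement. It agrees with the distance to the boundary on
`ω`, is 1-Lipschitz, and is positive exactly on `ω`. Both inequalities rest on a one-step Hardy
estimate, `hardy_gain_one`: for `b > -1`, `∫ d^b |v|^p` is controlled by `∫ d^(b+1) |v|^p` and `∫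
d^(b+p) |∇v|^p`.

Near a boundary point, `ω` is `{h > 0}` with `∂ₑh = 1` and `h` comparable to `d`. Integrating
`∂ₑ(h^(b+1) |v|^p)` against cutoffs produces `(b+1) ∫ h^b |v|^p`, which is where `b > -1` enters.
Young's inequality absorbs the cross term, and the derivative of the cutoff costs only the better
weight `h^(b+1)` (`hardy_directional`, `hardy_boundary_chart`). Compactness of `closure ω` makes the
estimate global.

For `b ≥ 0` the left side is finite when `v ∈ L^p`, so the `d^(b+1)` term can be absorbed: close to
the boundary it is a small multiple of `d^b`, and away from it a local Poincaré inequality with an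
`L^1` term takes over (`hardy_of_nonneg`). That inequality averages over small balls, so
connectedness plays no role. For `b = a - p`, possibly negative, one gain step reaches the exponent
`a - p + 1 > 0`, which gives (ii).

For (i), the Gagliardo–Nirenberg–Sobolev inequality is applied to `φ u` with `φ ≈ d^(a/p)`. The term
`u ∇φ` contributes `∫ d^(a-p) |u|^p`, which (ii) controls.

The local estimates are proved for smooth functions, with slightly larger sets `{d > τ}` on the
right. Mollification at scale below `τ/2`, Fatou's lemma and `τ → 0` carry them to Sobolev functions
(`transfer_smooth`, `wInt_le_of_forall_pos`), so no density theorem in weighted spaces is needed. -/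

/-- The weighted integral `∫_S dist(x, ωᶜ)^β ‖f‖^q`. -/
noncomputable def wInt {n : ℕ} {F : Type*} [NormedAddCommGroup F] (ω S : Set (EucSp n)) (β q : ℝ)
    (f : EucSp n → F) : ℝ≥0∞ :=
  ∫⁻ x in S, ENNReal.ofReal (infDist x ωᶜ ^ β) * ‖f x‖ₑ ^ q

/-! ### Distance to the boundary versus distance to the complement -/

section Geometry

variable {n : ℕ} {ω : Set (EucSp n)}

/-- The ball is connected and misses the frontier, so it lies in the union of the disjoint open sets
`ω` and `(closure ω)ᶜ`; its centre selects the first. -/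
lemma ball_infDist_frontier_subset {E : Type*} [NormedAddCommGroup E] [NormedSpace ℝ E]
    {ω : Set E} (hω : IsOpen ω) {x : E} (hx : x ∈ ω) :
    ball x (infDist x (frontier ω)) ⊆ ω := by
  have hpre : IsPreconnected (ball x (infDist x (frontier ω))) := (convex_ball _ _).isPreconnected
  rcases (ball x (infDist x (frontier ω))).eq_empty_or_nonempty with h | h
  · simp [h]
  have hpos : 0 < infDist x (frontier ω) := by
    by_contra hc
    rw [ball_eq_empty.2 (not_lt.1 hc)] at h
    exact h.ne_empty rfl
  refine hpre.subset_left_of_subset_union hω isClosed_closure.isOpen_compl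
    (disjoint_compl_right_iff_subset.2 subset_closure) ?_ ⟨x, mem_ball_self hpos, hx⟩
  intro y hy
  by_contra hyn
  simp only [mem_union, mem_compl_iff, not_or, not_not] at hyn
  have : y ∈ frontier ω := by rw [hω.frontier_eq]; exact ⟨hyn.2, hyn.1⟩
  have h1 := infDist_le_dist_of_mem (x := x) this
  rw [mem_ball, dist_comm] at hy
  linarith

lemma infDist_frontier_eq {E : Type*} [NormedAddCommGroup E] [NormedSpace ℝ E]
    {ω : Set E} (hω : IsOpen ω) (hf : (frontier ω).Nonempty) {x : E} (hx : x ∈ ω) :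
    infDist x (frontier ω) = infDist x ωᶜ := by
  have hsub : frontier ω ⊆ ωᶜ := by rw [hω.frontier_eq]; exact fun y hy => hy.2
  refine le_antisymm ?_ (infDist_le_infDist_of_subset hsub hf)
  refine (le_infDist (hf.mono hsub)).2 fun y hy => ?_
  by_contra hc
  push Not at hc
  exact hy (ball_infDist_frontier_subset hω hx (by rwa [mem_ball, dist_comm]))

lemma infDist_compl_pos_iff (hω : IsOpen ω) (hc : ωᶜ.Nonempty) {x : EucSp n} :
    0 < infDist x ωᶜ ↔ x ∈ ω := by
  rw [← hω.isClosed_compl.notMem_iff_infDist_pos hc, notMem_compl_iff]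

lemma infDist_sub_le {E : Type*} [PseudoMetricSpace E] (s : Set E) (x y : E) :
    infDist x s - dist x y ≤ infDist y s := by
  linarith [infDist_le_infDist_add_dist (s := s) (x := x) (y := y)]

lemma compl_nonempty_of_isBounded (hn : 0 < n) (hb : Bornology.IsBounded ω) :
    ωᶜ.Nonempty := by
  rw [nonempty_compl]
  rintro rfl
  have : Nonempty (Fin n) := ⟨⟨0, hn⟩⟩
  exact NormedSpace.unbounded_univ ℝ (EucSp n) hb

lemma frontier_nonempty_of_isBounded (hn : 0 < n) (hb : Bornology.IsBounded ω)
    (hne : ω.Nonempty) : (frontier ω).Nonempty :=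
  nonempty_frontier_iff.2 ⟨hne, nonempty_compl.1 (compl_nonempty_of_isBounded hn hb)⟩

end Geometry

/-! ### Jensen-type inequalities for lower integrals -/

section Jensen

variable {α : Type*} [MeasurableSpace α]

lemma lintegral_rpow_le_measure_mul {μ : Measure α} {p : ℝ} (hp : 1 ≤ p) {f : α → ℝ≥0∞}
    (hf : AEMeasurable f μ) :
    (∫⁻ x, f x ∂μ) ^ p ≤ μ univ ^ (p - 1) * ∫⁻ x, f x ^ p ∂μ := by
  rcases hp.eq_or_lt with rfl | hp'
  · simp
  have hpq := Real.HolderConjugate.conjExponent hp'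
  have h := ENNReal.lintegral_mul_le_Lp_mul_Lq μ hpq hf (aemeasurable_const (b := (1 : ℝ≥0∞)))
  simp only [Pi.mul_apply, mul_one, ENNReal.one_rpow, lintegral_const, one_mul] at h
  have hp0 : 0 < p := by linarith
  calc (∫⁻ x, f x ∂μ) ^ p
      ≤ ((∫⁻ x, f x ^ p ∂μ) ^ (1 / p) * μ univ ^ (1 / p.conjExponent)) ^ p := by gcongr
    _ = μ univ ^ (p - 1) * ∫⁻ x, f x ^ p ∂μ := by
      rw [ENNReal.mul_rpow_of_nonneg _ _ hp0.le, ← ENNReal.rpow_mul, ← ENNReal.rpow_mul,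
        one_div_mul_cancel hp0.ne', ENNReal.rpow_one, mul_comm]
      congr 2
      rw [Real.conjExponent]
      field_simp

/-- Jensen for a density of mass at most one: the mass enters Hölder's inequality with the
nonnegative exponent `p - 1`, so it can be dropped. Mollifier kernels restricted to `ω` are the
intended densities. -/
lemma lintegral_mul_rpow_le {μ : Measure α} {p : ℝ} (hp : 1 ≤ p) {w f : α → ℝ≥0∞}
    (hw : Measurable w) (hw1 : ∫⁻ x, w x ∂μ ≤ 1) (hf : AEMeasurable f μ) :
    (∫⁻ x, w x * f x ∂μ) ^ p ≤ ∫⁻ x, w x * f x ^ p ∂μ := by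
  have hac : μ.withDensity w ≪ μ := withDensity_absolutelyContinuous _ _
  have h := lintegral_rpow_le_measure_mul (μ := μ.withDensity w) hp (hf.mono_ac hac)
  rw [lintegral_withDensity_eq_lintegral_mul₀ hw.aemeasurable hf,
    lintegral_withDensity_eq_lintegral_mul₀ hw.aemeasurable (hf.pow_const p)] at h
  refine h.trans ?_
  calc _ ≤ (1 : ℝ≥0∞) * ∫⁻ x, w x * f x ^ p ∂μ := by
        gcongr
        · rw [withDensity_apply _ MeasurableSet.univ, Measure.restrict_univ]
          exact ENNReal.rpow_le_one hw1 (by linarith)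
        · rfl
    _ = _ := one_mul _

lemma ENNReal.add_rpow_le_two_rpow_mul {p : ℝ} (hp : 0 ≤ p) (a b : ℝ≥0∞) :
    (a + b) ^ p ≤ 2 ^ p * (a ^ p + b ^ p) := by
  have h : a + b ≤ 2 * max a b := by
    rw [two_mul]; exact add_le_add (le_max_left _ _) (le_max_right _ _)
  calc (a + b) ^ p ≤ (2 * max a b) ^ p := by gcongr
    _ = 2 ^ p * (max a b) ^ p := ENNReal.mul_rpow_of_nonneg _ _ hp
    _ ≤ _ := by
      gcongr
      rcases max_cases a b with h | h <;> rw [h.1]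
      · exact le_self_add
      · exact le_add_self

end Jensen

/-! ### Elementary facts on the weighted integrals -/

section WInt

variable {n : ℕ} {ω : Set (EucSp n)} {F : Type*} [NormedAddCommGroup F]

lemma measurable_weight (ω : Set (EucSp n)) (β : ℝ) :
    Measurable fun x : EucSp n => ENNReal.ofReal (infDist x ωᶜ ^ β) :=
  ((measurable_infDist).pow_const β).ennreal_ofReal

lemma measurableSet_lt_infDist (ω : Set (EucSp n)) (τ : ℝ) :
    MeasurableSet {x | τ < infDist x ωᶜ} :=
  measurableSet_lt measurable_const measurable_infDist

lemma wInt_mono_set {S T : Set (EucSp n)} (h : S ⊆ T) (β q : ℝ) (f : EucSp n → F) :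
    wInt ω S β q f ≤ wInt ω T β q f :=
  lintegral_mono_set h

lemma rpow_le_rpow_abs_mul {L s t : ℝ} (hL : 0 < L) (hs : 0 < s) (ht : 0 < t) (h1 : s ≤ L * t)
    (h2 : t ≤ L * s) (β : ℝ) : s ^ β ≤ L ^ |β| * t ^ β := by
  rcases le_total 0 β with hβ | hβ
  · rw [abs_of_nonneg hβ, ← Real.mul_rpow hL.le ht.le]
    exact Real.rpow_le_rpow hs.le h1 hβ
  · rw [abs_of_nonpos hβ, Real.rpow_neg hL.le, ← Real.inv_rpow hL.le,
      ← Real.mul_rpow (by positivity) ht.le]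
    refine Real.rpow_le_rpow_of_nonpos (by positivity) ?_ hβ
    rw [inv_mul_le_iff₀ hL]
    exact h2

end WInt

/-! ### Mollification and passage from smooth to Sobolev functions -/

section Mollify

variable {n : ℕ} {ω : Set (EucSp n)}

/-- Jensen moves the power `q` inside the average and Tonelli removes the kernel. Where the kernel
is nonzero, `x` and `y` are within `τ/2` while `d x > τ`, so `d x` and `d y` differ by a factor at
most 2. This is the whole price `2 ^ |β|`. -/
lemma wInt_le_of_kernel_bound {F F' : Type*} [NormedAddCommGroup F] [NormedAddCommGroup F']
    {τ : ℝ} (hτ : 0 < τ) {ρ : EucSp n → ℝ}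
    (hρc : Continuous ρ) (hρ1 : ∫⁻ x, ENNReal.ofReal (ρ x) = 1)
    (hρs : ∀ x, ρ x ≠ 0 → ‖x‖ < τ / 2) {f : EucSp n → F}
    (hf : AEStronglyMeasurable f (volume.restrict ω)) {w : EucSp n → F'}
    (hw : ∀ x, τ < infDist x ωᶜ → ‖w x‖ₑ ≤ ∫⁻ y in ω, ENNReal.ofReal (ρ (x - y)) * ‖f y‖ₑ)
    (β : ℝ) {q : ℝ} (hq : 1 ≤ q) :
    wInt ω {x | τ < infDist x ωᶜ} β q w ≤ ENNReal.ofReal (2 ^ |β|) * wInt ω ω β q f := by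
  set κ : EucSp n → EucSp n → ℝ≥0∞ := fun x y => ENNReal.ofReal (ρ (x - y)) with hκ
  have hκm : Measurable (Function.uncurry κ) := by
    apply ENNReal.measurable_ofReal.comp
    exact (hρc.measurable).comp (measurable_fst.sub measurable_snd)
  set H : EucSp n → ℝ≥0∞ := fun y => ENNReal.ofReal (infDist y ωᶜ ^ β) * ‖f y‖ₑ ^ q with hH
  have hHm : AEMeasurable H (volume.restrict ω) :=
    (measurable_weight ω β).aemeasurable.mul (hf.enorm.pow_const q)
  have key : ∀ x, τ < infDist x ωᶜ → ENNReal.ofReal (infDist x ωᶜ ^ β) * ‖w x‖ₑ ^ q ≤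
      ∫⁻ y in ω, κ x y * (ENNReal.ofReal (2 ^ |β|) * H y) := by
    intro x hx
    have hq0 : 0 ≤ q := by linarith
    have hκx : Measurable (κ x) := hκm.of_uncurry_left
    calc ENNReal.ofReal (infDist x ωᶜ ^ β) * ‖w x‖ₑ ^ q
        ≤ ENNReal.ofReal (infDist x ωᶜ ^ β) * ∫⁻ y in ω, κ x y * ‖f y‖ₑ ^ q := by
          gcongr
          refine (ENNReal.rpow_le_rpow (hw x hx) hq0).trans
            (lintegral_mul_rpow_le hq hκx ?_ hf.enorm)
          refine (setLIntegral_le_lintegral _ _).trans_eq ?_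
          rw [lintegral_sub_left_eq_self (μ := volume) (fun z => ENNReal.ofReal (ρ z)) x, hρ1]
      _ = ∫⁻ y in ω, ENNReal.ofReal (infDist x ωᶜ ^ β) * (κ x y * ‖f y‖ₑ ^ q) := by
          rw [lintegral_const_mul' _ _ ENNReal.ofReal_ne_top]
      _ ≤ _ := by
          refine lintegral_mono fun y => ?_
          by_cases h0 : ρ (x - y) = 0
          · simp [hκ, h0]
          have hd : dist x y < τ / 2 := by rw [dist_eq_norm]; exact hρs _ h0
          have h1 := infDist_sub_le ωᶜ x y
          have h2 := infDist_sub_le ωᶜ y x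
          rw [dist_comm] at h2
          have := rpow_le_rpow_abs_mul two_pos (s := infDist x ωᶜ) (t := infDist y ωᶜ)
            (by linarith) (by linarith) (by linarith) (by linarith) β
          have h3 : ENNReal.ofReal (infDist x ωᶜ ^ β) ≤
              ENNReal.ofReal (2 ^ |β|) * ENNReal.ofReal (infDist y ωᶜ ^ β) := by
            rw [← ENNReal.ofReal_mul (by positivity)]
            exact ENNReal.ofReal_le_ofReal this
          calc _ ≤ (ENNReal.ofReal (2 ^ |β|) * ENNReal.ofReal (infDist y ωᶜ ^ β)) *
                (κ x y * ‖f y‖ₑ ^ q) := by gcongr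
            _ = _ := by simp only [hH]; ring
  calc wInt ω {x | τ < infDist x ωᶜ} β q w
      ≤ ∫⁻ x in {x | τ < infDist x ωᶜ}, ∫⁻ y in ω, κ x y * (ENNReal.ofReal (2 ^ |β|) * H y) :=
        setLIntegral_mono' (measurableSet_lt_infDist ω τ) key
    _ ≤ ∫⁻ x, ∫⁻ y in ω, κ x y * (ENNReal.ofReal (2 ^ |β|) * H y) :=
        setLIntegral_le_lintegral _ _
    _ = ∫⁻ y in ω, ∫⁻ x, κ x y * (ENNReal.ofReal (2 ^ |β|) * H y) := by
        rw [lintegral_lintegral_swap]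
        exact hκm.aemeasurable.mul ((hHm.const_mul _).comp_snd)
    _ = ∫⁻ y in ω, ENNReal.ofReal (2 ^ |β|) * H y := by
        refine lintegral_congr fun y => ?_
        have hκy : Measurable fun x => κ x y := hκm.of_uncurry_right
        rw [lintegral_mul_const _ hκy]
        rw [hκ, lintegral_sub_right_eq_self (μ := volume) (fun z => ENNReal.ofReal (ρ z)) y, hρ1,
          one_mul]
    _ = _ := by
        rw [lintegral_const_mul' _ _ ENNReal.ofReal_ne_top]
        rfl

open scoped Convolution in
-- The derivative falls on the kernel, and `y ↦ ρ (x - y)` is an admissible test function because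
-- `closedBall x ε ⊆ ω`. The sign from reflecting the argument cancels the sign in the definition of
-- the weak gradient.
lemma fderiv_convolution_indicator_eq {v : EucSp n → ℝ} {g : EucSp n → EucSp n}
    (hω : IsOpen ω) (hv : IntegrableOn v ω) (hvg : IsWeakGradient ω v g)
    {ρ : EucSp n → ℝ} (hρ : ContDiff ℝ ((⊤ : ℕ∞) : WithTop ℕ∞) ρ) {ε : ℝ}
    (hρs : tsupport ρ ⊆ closedBall 0 ε) {x : EucSp n} (hx : closedBall x ε ⊆ ω) (i : Fin n) :
    fderiv ℝ (ρ ⋆[ContinuousLinearMap.lsmul ℝ ℝ, volume] ω.indicator v) x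
        (EuclideanSpace.single i 1) = ∫ y in ω, g y i * ρ (x - y) := by
  have hρcs : HasCompactSupport ρ :=
    (isCompact_closedBall 0 ε).of_isClosed_subset (isClosed_tsupport _) hρs
  have hv' : LocallyIntegrable (ω.indicator v) volume :=
    ((integrable_indicator_iff hω.measurableSet).2 hv).locallyIntegrable
  have hd := hρcs.hasFDerivAt_convolution_left (ContinuousLinearMap.lsmul ℝ ℝ)
    (μ := volume) (hρ.of_le (by exact_mod_cast le_top)) hv' x
  rw [hd.fderiv]
  have hcd : HasCompactSupport (fderiv ℝ ρ) := hρcs.fderiv ℝ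
  have hcont : Continuous (fderiv ℝ ρ) := hρ.continuous_fderiv (by simp)
  have hex := hcd.convolutionExists_left (L := (ContinuousLinearMap.lsmul ℝ ℝ).precompL (EucSp n)) (μ := volume) hcont hv' x
  rw [convolution_eq_swap]
  rw [ContinuousLinearMap.integral_apply (by
    have := hex.integrable_swap
    simpa using this)]
  have h1 := hvg (fun y => ρ (x - y)) (hρ.comp (contDiff_const.sub contDiff_id)) ?_ ?_ i
  · rw [← neg_eq_iff_eq_neg] at h1
    rw [← h1, ← integral_indicator hω.measurableSet, ← integral_neg]
    refine integral_congr_ae (Eventually.of_forall fun y => ?_)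
    have h2 : fderiv ℝ (fun y => ρ (x - y)) y = - fderiv ℝ ρ (x - y) := by
      have h3 := (((hρ.differentiable (by simp)) (x - y)).hasFDerivAt).comp y
        ((hasFDerivAt_id y).const_sub x)
      rw [show (fun y => ρ (x - y)) = ρ ∘ fun y => x - y from rfl, HasFDerivAt.fderiv h3]
      ext; simp
    by_cases hy : y ∈ ω
    · simp [hy, h2, ContinuousLinearMap.precompL_apply, mul_comm]
    · simp [hy]
  · exact hρcs.comp_homeomorph (Homeomorph.subLeft x)
  · intro y hy
    apply hx
    have : tsupport (fun y => ρ (x - y)) ⊆ (fun y => x - y) ⁻¹' tsupport ρ :=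
      tsupport_comp_subset_preimage ρ (f := fun y => x - y) (by fun_prop)
    have h2 := hρs (this hy)
    rw [mem_closedBall_zero_iff] at h2
    rwa [mem_closedBall, dist_comm, dist_eq_norm]

/-- The derivative is the inner product with the vector integral `G`, so its operator norm is
exactly `‖G‖`; estimating coordinate by coordinate would cost a dimensional factor. -/
lemma enorm_fderiv_convolution_le {v : EucSp n → ℝ} {g : EucSp n → EucSp n}
    (hω : IsOpen ω) (hv : IntegrableOn v ω) (hg : IntegrableOn g ω) (hvg : IsWeakGradient ω v g)
    {ρ : EucSp n → ℝ} (hρ0 : ∀ x, 0 ≤ ρ x) (hρ : ContDiff ℝ ((⊤ : ℕ∞) : WithTop ℕ∞) ρ) {ε : ℝ}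
    (hρs : tsupport ρ ⊆ closedBall 0 ε) {x : EucSp n} (hx : closedBall x ε ⊆ ω) :
    ‖fderiv ℝ (convolution ρ (ω.indicator v) (ContinuousLinearMap.lsmul ℝ ℝ) volume) x‖ₑ ≤
      ∫⁻ y in ω, ENNReal.ofReal (ρ (x - y)) * ‖g y‖ₑ := by
  have hρcs : HasCompactSupport ρ :=
    (isCompact_closedBall 0 ε).of_isClosed_subset (isClosed_tsupport _) hρs
  obtain ⟨M, hM⟩ := hρcs.exists_bound_of_continuous hρ.continuous
  have hint : IntegrableOn (fun y => ρ (x - y) • g y) ω := by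
    refine Integrable.bdd_smul hg M ?_ (Eventually.of_forall fun y => hM _)
    exact (hρ.continuous.comp (by fun_prop)).aestronglyMeasurable
  set G : EucSp n := ∫ y in ω, ρ (x - y) • g y with hG
  have hfd : fderiv ℝ (convolution ρ (ω.indicator v) (ContinuousLinearMap.lsmul ℝ ℝ) volume) x
      = innerSL ℝ G := by
    apply ContinuousLinearMap.coe_injective
    refine (EuclideanSpace.basisFun (Fin n) ℝ).toBasis.ext fun i => ?_
    have h1 := fderiv_convolution_indicator_eq hω hv hvg hρ hρs hx i
    have h2 : G i = ∫ y in ω, g y i * ρ (x - y) := by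
      have := (EuclideanSpace.proj (𝕜 := ℝ) i).integral_comp_comm hint
      rw [hG]
      refine (this.symm.trans ?_)
      simp [mul_comm]
    simp only [OrthonormalBasis.coe_toBasis, EuclideanSpace.basisFun_apply,
      ContinuousLinearMap.coe_coe, innerSL_apply_apply]
    rw [h1, EuclideanSpace.inner_single_right, ← h2]
    simp
  rw [hfd, show ‖innerSL ℝ G‖ₑ = ‖G‖ₑ by
    rw [← ofReal_norm, ← ofReal_norm, innerSL_apply_norm]]
  refine (enorm_integral_le_lintegral_enorm _).trans_eq (lintegral_congr fun y => ?_)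
  rw [enorm_smul, Real.enorm_of_nonneg (hρ0 _)]

/-- Almost everywhere convergence plus bounds uniform in `j` is all that Fatou requires. The same
sequence serves every weight and exponent, so several terms of one inequality can be treated
together. -/
lemma exists_smooth_approx (hω : IsOpen ω) (hb : Bornology.IsBounded ω) (hc : ωᶜ.Nonempty)
    {p : ℝ} (hp : 1 ≤ p) {v : EucSp n → ℝ} {g : EucSp n → EucSp n} (h : IsSobolevW1 p ω v g)
    {τ : ℝ} (hτ : 0 < τ) :
    ∃ u : ℕ → EucSp n → ℝ, (∀ j, ContDiff ℝ ((⊤ : ℕ∞) : WithTop ℕ∞) (u j)) ∧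
      (∀ᵐ x ∂volume.restrict ω, Tendsto (fun j => u j x) atTop (𝓝 (v x))) ∧
      (∀ j β q, 1 ≤ q → wInt ω {x | τ < infDist x ωᶜ} β q (u j) ≤
        ENNReal.ofReal (2 ^ |β|) * wInt ω ω β q v) ∧
      (∀ j β q, 1 ≤ q → wInt ω {x | τ < infDist x ωᶜ} β q (fderiv ℝ (u j)) ≤
        ENNReal.ofReal (2 ^ |β|) * wInt ω ω β q g) := by
  have : IsFiniteMeasure (volume.restrict ω) := ⟨by
    rw [Measure.restrict_apply_univ]; exact hb.measure_lt_top⟩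
  have hp' : (1 : ℝ≥0∞) ≤ ENNReal.ofReal p := by
    rw [← ENNReal.ofReal_one]; exact ENNReal.ofReal_le_ofReal hp
  have hv : IntegrableOn v ω := h.memLp.integrable hp'
  have hg : IntegrableOn g ω := h.memLp_grad.integrable hp'
  have hvl : LocallyIntegrable (ω.indicator v) volume :=
    ((integrable_indicator_iff hω.measurableSet).2 hv).locallyIntegrable
  -- The shift by 2 keeps every radius, including the first, strictly below `τ / 2`.
  have hε : ∀ j : ℕ, 0 < τ / 2 / (j + 2) := fun j => by positivity
  have hε2 : ∀ j : ℕ, τ / 2 / (j + 2) < τ / 2 := fun j =>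
    div_lt_self (by positivity) (by linarith [(Nat.cast_nonneg j : (0 : ℝ) ≤ j)])
  let φ : ℕ → ContDiffBump (0 : EucSp n) := fun j =>
    ⟨τ / 2 / (j + 2) / 2, τ / 2 / (j + 2), half_pos (hε j), half_lt_self (hε j)⟩
  have hφo : ∀ j, (φ j).rOut = τ / 2 / (j + 2) := fun j => rfl
  let ρ : ℕ → EucSp n → ℝ := fun j => (φ j).normed volume
  have hρ0 : ∀ j x, 0 ≤ ρ j x := fun j x => (φ j).nonneg_normed x
  have hρ1 : ∀ j, ∫⁻ x, ENNReal.ofReal (ρ j x) = 1 := fun j => by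
    rw [← ofReal_integral_eq_lintegral_ofReal (φ j).integrable_normed
      (Eventually.of_forall (hρ0 j)), (φ j).integral_normed, ENNReal.ofReal_one]
  have hρsm : ∀ j, ContDiff ℝ ((⊤ : ℕ∞) : WithTop ℕ∞) (ρ j) := fun j => (φ j).contDiff_normed
  have hρs : ∀ j x, ρ j x ≠ 0 → ‖x‖ < τ / 2 := fun j x hx => by
    have : x ∈ Function.support ((φ j).normed volume) := hx
    rw [(φ j).support_normed_eq, mem_ball_zero_iff] at this
    exact this.trans (hε2 j)
  refine ⟨fun j => convolution (ρ j) (ω.indicator v) (ContinuousLinearMap.lsmul ℝ ℝ) volume,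
    fun j => (φ j).hasCompactSupport_normed.contDiff_convolution_left _ (hρsm j) hvl, ?_,
    fun j β q hq => wInt_le_of_kernel_bound hτ (hρsm j).continuous (hρ1 j) (hρs j)
      h.memLp.1 (fun x _ => ?_) β hq,
    fun j β q hq => wInt_le_of_kernel_bound hτ (hρsm j).continuous (hρ1 j) (hρs j)
      h.memLp_grad.1 (fun x hx => ?_) β hq⟩
  · have hlim := ContDiffBump.ae_convolution_tendsto_right_of_locallyIntegrable (φ := φ)
      (l := atTop) (K := 2) (μ := volume) ?_ (Eventually.of_forall fun j => ?_) hvl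
    · filter_upwards [ae_restrict_of_ae hlim, ae_restrict_mem hω.measurableSet] with x hx hxω
      rwa [indicator_of_mem hxω] at hx
    · simp only [hφo]
      exact tendsto_const_nhds.div_atTop
        (tendsto_atTop_add_const_right _ _ tendsto_natCast_atTop_atTop)
    · change τ / 2 / (j + 2) ≤ 2 * (τ / 2 / (j + 2) / 2)
      linarith
  · beta_reduce
    rw [convolution_eq_swap]
    refine (enorm_integral_le_lintegral_enorm _).trans_eq ?_
    rw [← lintegral_indicator hω.measurableSet]
    refine lintegral_congr fun y => ?_
    by_cases hy : y ∈ ω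
    · simp [hy, enorm_mul, Real.enorm_of_nonneg (hρ0 j _)]
    · simp [hy]
  · refine enorm_fderiv_convolution_le hω hv hg h.isWeakGradient (hρ0 j) (hρsm j)
      (φ j).tsupport_normed_eq.subset fun y hy => ?_
    rw [← infDist_compl_pos_iff hω hc]
    have h1 := infDist_sub_le ωᶜ x y
    rw [mem_closedBall, dist_comm, hφo] at hy
    linarith [hε2 j]

/-- An inequality between weighted integrals of smooth functions passes to Sobolev functions. -/
lemma transfer_smooth (hω : IsOpen ω) (hb : Bornology.IsBounded ω) (hc : ωᶜ.Nonempty)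
    {p : ℝ} (hp : 1 ≤ p) {v : EucSp n → ℝ} {g : EucSp n → EucSp n} (h : IsSobolevW1 p ω v g)
    {τ : ℝ} (hτ : 0 < τ) {S : Set (EucSp n)} (hSω : S ⊆ ω)
    {β q θ k b a : ℝ} (hθ : 0 < θ) {C₁ C₂ C₃ : ℝ≥0∞}
    (hu : ∀ u : EucSp n → ℝ, ContDiff ℝ ((⊤ : ℕ∞) : WithTop ℕ∞) u →
      (wInt ω S β q u) ^ θ ≤ C₁ * (wInt ω {x | τ < infDist x ωᶜ} k 1 u) ^ p +
        C₂ * wInt ω {x | τ < infDist x ωᶜ} b p u +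
        C₃ * wInt ω {x | τ < infDist x ωᶜ} a p (fderiv ℝ u)) :
    (wInt ω S β q v) ^ θ ≤
      C₁ * (ENNReal.ofReal (2 ^ |k|) * wInt ω ω k 1 v) ^ p +
        C₂ * (ENNReal.ofReal (2 ^ |b|) * wInt ω ω b p v) +
        C₃ * (ENNReal.ofReal (2 ^ |a|) * wInt ω ω a p g) := by
  obtain ⟨u, hus, hlim, h1, h2⟩ := exists_smooth_approx hω hb hc hp h hτ
  set R := C₁ * (ENNReal.ofReal (2 ^ |k|) * wInt ω ω k 1 v) ^ p +
        C₂ * (ENNReal.ofReal (2 ^ |b|) * wInt ω ω b p v) +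
        C₃ * (ENNReal.ofReal (2 ^ |a|) * wInt ω ω a p g) with hR
  -- The outer power `θ` is inverted first, since Fatou acts on the bare integral.
  have hj : ∀ j, wInt ω S β q (u j) ≤ R ^ θ⁻¹ := fun j => by
    rw [ENNReal.le_rpow_inv_iff hθ]
    refine (hu _ (hus j)).trans ?_
    rw [hR]
    gcongr
    · exact h1 j k 1 le_rfl
    · exact h1 j b p hp
    · exact h2 j a p hp
  rw [← ENNReal.le_rpow_inv_iff hθ]
  have hae : ∀ᵐ x ∂volume.restrict S, ENNReal.ofReal (infDist x ωᶜ ^ β) * ‖v x‖ₑ ^ q =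
      liminf (fun j => ENNReal.ofReal (infDist x ωᶜ ^ β) * ‖u j x‖ₑ ^ q) atTop := by
    filter_upwards [ae_restrict_of_ae_restrict_of_subset hSω hlim] with x hx
    refine (Tendsto.liminf_eq ?_).symm
    refine ENNReal.Tendsto.const_mul ?_ (Or.inr ENNReal.ofReal_ne_top)
    exact (ENNReal.continuous_rpow_const.tendsto _).comp ((continuous_enorm.tendsto _).comp hx)
  calc wInt ω S β q v
      = ∫⁻ x in S, liminf (fun j => ENNReal.ofReal (infDist x ωᶜ ^ β) * ‖u j x‖ₑ ^ q) atTop :=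
        lintegral_congr_ae hae
    _ ≤ liminf (fun j => ∫⁻ x in S, ENNReal.ofReal (infDist x ωᶜ ^ β) * ‖u j x‖ₑ ^ q) atTop :=
        lintegral_liminf_le fun j =>
          (measurable_weight ω β).mul ((hus j).continuous.measurable.enorm.pow_const q)
    _ ≤ R ^ θ⁻¹ := by
        refine liminf_le_of_frequently_le' (Frequently.of_forall fun j => hj j)

/-- Exhaustion of `S ⊆ ω` by the sets `S ∩ {τ < dist(·, ωᶜ)}`. -/
lemma wInt_le_of_forall_pos {F : Type*} [NormedAddCommGroup F] (hω : IsOpen ω)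
    (hc : ωᶜ.Nonempty) {S : Set (EucSp n)} (hSω : S ⊆ ω) {β q : ℝ}
    {f : EucSp n → F} {R : ℝ≥0∞}
    (h : ∀ τ, 0 < τ → wInt ω (S ∩ {x | τ < infDist x ωᶜ}) β q f ≤ R) :
    wInt ω S β q f ≤ R := by
  have hU : S = ⋃ j : ℕ, S ∩ {x | 1 / ((j : ℝ) + 1) < infDist x ωᶜ} := by
    rw [← inter_iUnion]
    refine (inter_eq_left.2 fun x hx => ?_).symm
    obtain ⟨j, hj⟩ := exists_nat_one_div_lt ((infDist_compl_pos_iff hω hc).2 (hSω hx))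
    exact mem_iUnion.2 ⟨j, hj⟩
  rw [wInt, hU, setLIntegral_iUnion_of_directed]
  · exact iSup_le fun j => h _ (by positivity)
  · refine Monotone.directed_le fun i j hij => inter_subset_inter_right _ fun x hx => ?_
    have hij' : (i : ℝ) ≤ j := by exact_mod_cast hij
    have h1 : 1 / ((j : ℝ) + 1) ≤ 1 / ((i : ℝ) + 1) :=
      one_div_le_one_div_of_le (by positivity) (by linarith)
    exact h1.trans_lt hx

end Mollify

/-! ### Poincaré inequality away from the boundary -/

section Interior

variable {n : ℕ} {ω : Set (EucSp n)}

lemma wInt_le_mul_wInt {F : Type*} [NormedAddCommGroup F] {S : Set (EucSp n)}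
    (hS : MeasurableSet S) {β β' c : ℝ} (hc : 0 ≤ c)
    (h : ∀ x ∈ S, infDist x ωᶜ ^ β ≤ c * infDist x ωᶜ ^ β') (q : ℝ) (f : EucSp n → F) :
    wInt ω S β q f ≤ ENNReal.ofReal c * wInt ω S β' q f := by
  rw [wInt, wInt, ← lintegral_const_mul' _ _ ENNReal.ofReal_ne_top]
  refine setLIntegral_mono' hS fun x hx => ?_
  rw [← mul_assoc, ← ENNReal.ofReal_mul hc]
  gcongr
  exact h x hx

/-- On a set where the distance lies between two positive constants all weights are comparable. -/
lemma exists_rpow_le_mul_rpow {m D : ℝ} (hm : 0 < m) (β β' : ℝ) :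
    ∃ c : ℝ, 0 ≤ c ∧ ∀ t, m ≤ t → t ≤ D → t ^ β ≤ c * t ^ β' := by
  refine ⟨max (m ^ (β - β')) (D ^ (β - β')), le_max_of_le_left (by positivity), fun t h1 h2 => ?_⟩
  have ht : 0 < t := hm.trans_le h1
  have h3 : t ^ β = t ^ (β - β') * t ^ β' := by rw [← Real.rpow_add ht]; congr 1; ring
  rw [h3]
  gcongr
  rcases le_total 0 (β - β') with h | h
  · exact le_max_of_le_right (Real.rpow_le_rpow ht.le h2 h)
  · exact le_max_of_le_left (Real.rpow_le_rpow_of_nonpos hm h1 h)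

lemma exists_infDist_compl_le (hn : 0 < n) (hb : Bornology.IsBounded ω) :
    ∃ D : ℝ, 0 < D ∧ ∀ x ∈ ω, infDist x ωᶜ ≤ D := by
  obtain ⟨z, hz⟩ := compl_nonempty_of_isBounded hn hb
  obtain ⟨R, hR⟩ := hb.subset_closedBall z
  exact ⟨max R 1, lt_max_of_lt_right one_pos, fun x hx =>
    (infDist_le_dist_of_mem hz).trans (le_max_of_le_left (hR hx))⟩

lemma enorm_le_enorm_add_lintegral_fderiv {E : Type*} [NormedAddCommGroup E] [NormedSpace ℝ E]
    {u : E → ℝ} (hu : ContDiff ℝ 1 u)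
    (x : E) {y : E} {r : ℝ} (hy : ‖y‖ ≤ r) :
    ‖u x‖ₑ ≤ ‖u (x + y)‖ₑ +
      ENNReal.ofReal r * ∫⁻ t in Ioc (0 : ℝ) 1, ‖fderiv ℝ u (x + t • y)‖ₑ := by
  have hder : ∀ t ∈ uIcc (0 : ℝ) 1,
      HasDerivAt (fun t : ℝ => u (x + t • y)) (fderiv ℝ u (x + t • y) y) t := fun t _ => by
    have h1 : HasDerivAt (fun t : ℝ => x + t • y) y t := by
      simpa using ((hasDerivAt_id t).smul_const y).const_add x
    exact ((hu.differentiable one_ne_zero _).hasFDerivAt).comp_hasDerivAt t h1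
  have hcont : Continuous fun t : ℝ => fderiv ℝ u (x + t • y) y :=
    ((hu.continuous_fderiv one_ne_zero).comp (by fun_prop)).clm_apply continuous_const
  have hFTC := intervalIntegral.integral_eq_sub_of_hasDerivAt hder (hcont.intervalIntegrable _ _)
  simp only [one_smul, zero_smul, add_zero] at hFTC
  have h2 : u x = u (x + y) - ∫ t in (0 : ℝ)..1, fderiv ℝ u (x + t • y) y := by rw [hFTC]; ring
  rw [h2, intervalIntegral.integral_of_le zero_le_one]
  refine enorm_sub_le.trans ?_
  gcongr
  refine (enorm_integral_le_lintegral_enorm _).trans ?_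
  rw [← lintegral_const_mul' _ _ ENNReal.ofReal_ne_top]
  refine lintegral_mono fun t => ?_
  refine ((fderiv ℝ u (x + t • y)).le_opENorm y).trans ?_
  rw [mul_comm]
  gcongr
  rw [← ofReal_norm]
  exact ENNReal.ofReal_le_ofReal hy

lemma setLIntegral_add_right_le {E : Type*} [AddGroup E] [MeasurableSpace E] [MeasurableAdd E]
    {μ : Measure E} [μ.IsAddRightInvariant]
    {K U : Set E} (hK : MeasurableSet K) (hU : MeasurableSet U) {z : E}
    (h : ∀ x ∈ K, x + z ∈ U) (f : E → ℝ≥0∞) :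
    ∫⁻ x in K, f (x + z) ∂μ ≤ ∫⁻ x in U, f x ∂μ := by
  rw [← lintegral_indicator hK, ← lintegral_indicator hU,
    ← lintegral_add_right_eq_self (U.indicator f) z]
  refine lintegral_mono fun x => ?_
  by_cases hx : x ∈ K
  · simp [hx, h x hx]
  · simp [hx]

/-- Compare `u x` with `u (x + y)` along the segment and integrate over `‖y‖ < η / 2`. The values `u
(x + y)` add up to at most the `L^1` norm on the larger set, which contains every such segment, and
the gradient part is handled by Hölder and Tonelli. -/
lemma interior_poincare (hn : 0 < n) (hω : IsOpen ω) (hb : Bornology.IsBounded ω)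
    {p : ℝ} (hp : 1 ≤ p) {η : ℝ} (hη : 0 < η) :
    ∃ C : ℝ≥0, ∀ u : EucSp n → ℝ, ContDiff ℝ 1 u →
      wInt ω {x | η < infDist x ωᶜ} 0 p u ≤
        C * (wInt ω {x | η / 2 < infDist x ωᶜ} 0 1 u) ^ p +
        C * wInt ω {x | η / 2 < infDist x ωᶜ} 0 p (fderiv ℝ u) := by
  have hc := compl_nonempty_of_isBounded hn hb
  set K := {x | η < infDist x ωᶜ} with hK
  set U := {x | η / 2 < infDist x ωᶜ} with hU
  set r := η / 2 with hr
  have hr0 : 0 < r := by positivity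
  have hKm : MeasurableSet K := measurableSet_lt_infDist ω η
  have hUm : MeasurableSet U := measurableSet_lt_infDist ω r
  set B : Set (EucSp n) := ball 0 r with hB
  set V := volume B with hV
  have hV0 : V ≠ 0 := (measure_ball_pos volume _ hr0).ne'
  have hVt : V ≠ ∞ := measure_ball_lt_top.ne
  have hp0 : 0 ≤ p := by linarith
  have hKU : ∀ x ∈ K, ∀ z ∈ B, x + z ∈ U := by
    intro x hx z hz
    have h1 := infDist_sub_le ωᶜ x (x + z)
    rw [dist_self_add_right] at h1
    rw [hB, mem_ball_zero_iff] at hz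
    change η / 2 < _
    have hx' : η < infDist x ωᶜ := hx
    linarith
  have hKfin : volume K ≠ ∞ := by
    refine (lt_of_le_of_lt (measure_mono fun x hx => ?_) hb.measure_lt_top).ne
    rw [← infDist_compl_pos_iff hω hc]
    exact hη.trans hx
  set I : Set ℝ := Ioc 0 1
  set Q : Measure (EucSp n × ℝ) := (volume.restrict B).prod (volume.restrict I) with hQ
  have hQu : Q univ = V := by
    rw [hQ, ← univ_prod_univ, Measure.prod_prod]
    simp [I, hV]
  have hQr : Q = (volume : Measure (EucSp n × ℝ)).restrict (B ×ˢ I) := by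
    rw [hQ, Measure.prod_restrict]; rfl
  set A : ℝ≥0∞ := 2 ^ p * (volume K + ENNReal.ofReal r ^ p * V ^ p) / V ^ p with hA
  have hVp0 : V ^ p ≠ 0 := by simp [ENNReal.rpow_eq_zero_iff, hV0, hVt]
  have hVpt : V ^ p ≠ ∞ := ENNReal.rpow_ne_top_of_nonneg hp0 hVt
  have hAt : A ≠ ∞ := by
    rw [hA]
    refine ENNReal.div_ne_top (ENNReal.mul_ne_top
      (ENNReal.rpow_ne_top_of_nonneg hp0 (by simp)) (ENNReal.add_ne_top.2 ⟨hKfin,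
      ENNReal.mul_ne_top (ENNReal.rpow_ne_top_of_nonneg hp0 ENNReal.ofReal_ne_top) hVpt⟩)) hVp0
  refine ⟨A.toNNReal, fun u hu => ?_⟩
  rw [ENNReal.coe_toNNReal hAt]
  have hDc : Continuous (fderiv ℝ u) := hu.continuous_fderiv one_ne_zero
  set N := wInt ω U 0 1 u with hN
  set G := wInt ω U 0 p (fderiv ℝ u) with hG
  have hNe : N = ∫⁻ x in U, ‖u x‖ₑ := by simp [hN, wInt]
  have hGe : G = ∫⁻ x in U, ‖fderiv ℝ u x‖ₑ ^ p := by simp [hG, wInt]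
  have hjoint : Measurable fun z : EucSp n × (EucSp n × ℝ) =>
      ‖fderiv ℝ u (z.1 + z.2.2 • z.2.1)‖ₑ :=
    (hDc.comp (by fun_prop)).enorm.measurable
  have hpt : ∀ x ∈ K, V ^ p * ‖u x‖ₑ ^ p ≤ 2 ^ p * (N ^ p + ENNReal.ofReal r ^ p *
      (V ^ (p - 1) * ∫⁻ z, ‖fderiv ℝ u (x + z.2 • z.1)‖ₑ ^ p ∂Q)) := by
    intro x hx
    have hm : Measurable fun z : EucSp n × ℝ => ‖fderiv ℝ u (x + z.2 • z.1)‖ₑ :=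
      (hDc.comp (by fun_prop)).enorm.measurable
    have h1 : V * ‖u x‖ₑ ≤ N + ENNReal.ofReal r *
        ∫⁻ z, ‖fderiv ℝ u (x + z.2 • z.1)‖ₑ ∂Q := by
      calc V * ‖u x‖ₑ = ∫⁻ _ in B, ‖u x‖ₑ := by simp [hV, mul_comm]
        _ ≤ ∫⁻ y in B, (‖u (x + y)‖ₑ +
            ENNReal.ofReal r * ∫⁻ t in I, ‖fderiv ℝ u (x + t • y)‖ₑ) :=
            setLIntegral_mono' measurableSet_ball fun y hy =>
              enorm_le_enorm_add_lintegral_fderiv hu x (mem_ball_zero_iff.1 hy).le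
        _ = (∫⁻ y in B, ‖u (x + y)‖ₑ) +
            ENNReal.ofReal r * ∫⁻ y in B, ∫⁻ t in I, ‖fderiv ℝ u (x + t • y)‖ₑ := by
            have hum : Measurable fun y : EucSp n => ‖u (x + y)‖ₑ :=
              (hu.continuous.comp (by fun_prop)).enorm.measurable
            rw [lintegral_add_left hum, lintegral_const_mul' _ _ ENNReal.ofReal_ne_top]
        _ ≤ _ := by
            gcongr
            · rw [hNe]
              simp_rw [add_comm x]
              exact setLIntegral_add_right_le measurableSet_ball hUm
                (fun y hy => by rw [add_comm]; exact hKU x hx y hy) fun y => ‖u y‖ₑ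
            · rw [hQ, lintegral_prod _ hm.aemeasurable]
    calc V ^ p * ‖u x‖ₑ ^ p = (V * ‖u x‖ₑ) ^ p := (ENNReal.mul_rpow_of_nonneg _ _ hp0).symm
      _ ≤ (N + ENNReal.ofReal r * ∫⁻ z, ‖fderiv ℝ u (x + z.2 • z.1)‖ₑ ∂Q) ^ p := by gcongr
      _ ≤ 2 ^ p * (N ^ p + (ENNReal.ofReal r *
          ∫⁻ z, ‖fderiv ℝ u (x + z.2 • z.1)‖ₑ ∂Q) ^ p) := ENNReal.add_rpow_le_two_rpow_mul hp0 _ _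
      _ ≤ _ := by
          rw [ENNReal.mul_rpow_of_nonneg _ _ hp0, ← hQu]
          gcongr
          exact lintegral_rpow_le_measure_mul hp hm.aemeasurable
  -- For fixed `(y, t)` the map `x ↦ x + t • y` is a translation of `K` into `U`, so after swapping
  -- the integrals each inner one is at most `G`.
  have hswap : ∫⁻ x in K, ∫⁻ z, ‖fderiv ℝ u (x + z.2 • z.1)‖ₑ ^ p ∂Q ≤ V * G := by
    rw [lintegral_lintegral_swap (hjoint.pow_const p).aemeasurable, hQr]
    calc _ ≤ ∫⁻ _ in B ×ˢ I, G := by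
          refine setLIntegral_mono' (measurableSet_ball.prod measurableSet_Ioc) fun z hz => ?_
          rw [hGe]
          refine setLIntegral_add_right_le hKm hUm (fun x hx => hKU x hx _ ?_)
            fun y => ‖fderiv ℝ u y‖ₑ ^ p
          rw [hB, mem_ball_zero_iff, norm_smul, Real.norm_of_nonneg hz.2.1.le]
          have h1 := mem_ball_zero_iff.1 hz.1
          nlinarith [norm_nonneg z.1, hz.2.1, hz.2.2]
      _ = V * G := by
          rw [lintegral_const, ← hQr, hQu, mul_comm]
  have hfin : V ^ p * wInt ω K 0 p u ≤ 2 ^ p * (volume K * N ^ p + ENNReal.ofReal r ^ p *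
      (V ^ p * G)) := by
    have hVV : V ^ p = V ^ (p - 1) * V := by
      conv_rhs => rw [← ENNReal.rpow_one V, ← ENNReal.rpow_mul, one_mul]
      rw [← ENNReal.rpow_add _ _ hV0 hVt]; congr 1; ring
    calc V ^ p * wInt ω K 0 p u = ∫⁻ x in K, V ^ p * ‖u x‖ₑ ^ p := by
          rw [lintegral_const_mul' _ _ hVpt]; simp [wInt]
      _ ≤ ∫⁻ x in K, 2 ^ p * (N ^ p + ENNReal.ofReal r ^ p *
          (V ^ (p - 1) * ∫⁻ z, ‖fderiv ℝ u (x + z.2 • z.1)‖ₑ ^ p ∂Q)) :=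
          setLIntegral_mono' hKm hpt
      _ = 2 ^ p * (volume K * N ^ p + ENNReal.ofReal r ^ p *
          (V ^ (p - 1) * ∫⁻ x in K, ∫⁻ z, ‖fderiv ℝ u (x + z.2 • z.1)‖ₑ ^ p ∂Q)) := by
          rw [lintegral_const_mul' _ _ (ENNReal.rpow_ne_top_of_nonneg hp0 (by simp)),
            lintegral_add_left measurable_const,
            lintegral_const_mul' _ _ (ENNReal.rpow_ne_top_of_nonneg hp0 ENNReal.ofReal_ne_top),
            lintegral_const_mul' _ _ (ENNReal.rpow_ne_top_of_nonneg (by linarith) hVt)]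
          simp [mul_comm]
      _ ≤ _ := by
          have hX : V ^ (p - 1) * ∫⁻ x in K, ∫⁻ z, ‖fderiv ℝ u (x + z.2 • z.1)‖ₑ ^ p ∂Q ≤
              V ^ p * G := by
            rw [hVV, mul_assoc]
            exact mul_le_mul_right hswap _
          gcongr
  have hdiv : wInt ω K 0 p u ≤ 2 ^ p * (volume K * N ^ p + ENNReal.ofReal r ^ p *
      (V ^ p * G)) / V ^ p := by
    rw [ENNReal.le_div_iff_mul_le (Or.inl hVp0) (Or.inl hVpt), mul_comm]
    exact hfin
  have hkey : volume K * N ^ p + ENNReal.ofReal r ^ p * (V ^ p * G) ≤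
      (volume K + ENNReal.ofReal r ^ p * V ^ p) * (N ^ p + G) := by
    rw [add_mul, ← mul_assoc]
    gcongr
    · exact le_self_add
    · exact le_add_self
  calc _ ≤ _ := hdiv
    _ ≤ 2 ^ p * ((volume K + ENNReal.ofReal r ^ p * V ^ p) * (N ^ p + G)) / V ^ p := by gcongr
    _ = A * N ^ p + A * G := by
      rw [hA, ENNReal.div_eq_inv_mul, ENNReal.div_eq_inv_mul]; ring

end Interior

/-! ### A smooth step in the distance variable -/

section Step

/-- A smooth increasing step from `0` on `(-∞, τ]` to `1` on `[2τ, ∞)`. -/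
noncomputable def stepFn (τ t : ℝ) : ℝ := Real.smoothTransition (t / τ - 1)

variable {τ : ℝ}

lemma stepFn_nonneg (τ t : ℝ) : 0 ≤ stepFn τ t := Real.smoothTransition.nonneg _

lemma stepFn_le_one (τ t : ℝ) : stepFn τ t ≤ 1 := Real.smoothTransition.le_one _

lemma stepFn_eq_zero (hτ : 0 < τ) {t : ℝ} (ht : t ≤ τ) : stepFn τ t = 0 :=
  Real.smoothTransition.zero_of_nonpos (by rw [sub_nonpos, div_le_one hτ]; exact ht)

lemma stepFn_eq_one (hτ : 0 < τ) {t : ℝ} (ht : 2 * τ ≤ t) : stepFn τ t = 1 :=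
  Real.smoothTransition.one_of_one_le (by
    have : 2 ≤ t / τ := by rwa [le_div_iff₀ hτ]
    linarith)

lemma contDiff_stepFn (τ : ℝ) : ContDiff ℝ 1 (stepFn τ) :=
  (Real.smoothTransition.contDiff (n := 1)).comp
    ((contDiff_id.div_const τ).sub contDiff_const)

lemma stepFn_monotone (hτ : 0 < τ) : Monotone (stepFn τ) := fun s t hst =>
  Real.smoothTransition.monotone (by gcongr)

lemma deriv_stepFn_nonneg (hτ : 0 < τ) (t : ℝ) : 0 ≤ deriv (stepFn τ) t :=
  (stepFn_monotone hτ).deriv_nonneg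

lemma deriv_stepFn_eq_zero (hτ : 0 < τ) {t : ℝ} (ht : t < τ) : deriv (stepFn τ) t = 0 := by
  have : stepFn τ =ᶠ[𝓝 t] fun _ => 0 := by
    filter_upwards [gt_mem_nhds ht] with x hx using stepFn_eq_zero hτ hx.le
  rw [this.deriv_eq, deriv_const]

lemma deriv_stepFn_eq_zero_of_gt (hτ : 0 < τ) {t : ℝ} (ht : 2 * τ < t) :
    deriv (stepFn τ) t = 0 := by
  have : stepFn τ =ᶠ[𝓝 t] fun _ => 1 := by
    filter_upwards [lt_mem_nhds ht] with x hx using stepFn_eq_one hτ hx.le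
  rw [this.deriv_eq, deriv_const]

/-- The derivative has size `1 / τ` but lives where `τ ≤ t ≤ 2 * τ`, so multiplication by `t` gives
a bound independent of `τ`, as needed when `τ → 0`. -/
lemma exists_mul_deriv_stepFn_le :
    ∃ M : ℝ, 0 ≤ M ∧ ∀ τ, 0 < τ → ∀ t, |t| * |deriv (stepFn τ) t| ≤ M := by
  have hc : Continuous (deriv Real.smoothTransition) :=
    (Real.smoothTransition.contDiff (n := 1)).continuous_deriv le_rfl
  obtain ⟨M, hM⟩ := isCompact_Icc.exists_bound_of_continuousOn (s := Icc (0 : ℝ) 1) hc.continuousOn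
  have hM0 : 0 ≤ M := (norm_nonneg _).trans (hM 0 (by simp))
  refine ⟨2 * M, by positivity, fun τ hτ t => ?_⟩
  by_cases h1 : t < τ
  · simp [deriv_stepFn_eq_zero hτ h1, hM0]
  by_cases h2 : 2 * τ < t
  · simp [deriv_stepFn_eq_zero_of_gt hτ h2, hM0]
  push Not at h1 h2
  have ht : 0 < t := hτ.trans_le h1
  have hd : deriv (stepFn τ) t = deriv Real.smoothTransition (t / τ - 1) * (1 / τ) := by
    have h3 := (((Real.smoothTransition.contDiff (n := 1)).differentiable one_ne_zero
      (t / τ - 1)).hasDerivAt).comp t (((hasDerivAt_id t).div_const τ).sub_const 1)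
    exact h3.deriv
  have h4 : |deriv Real.smoothTransition (t / τ - 1)| ≤ M := by
    refine hM _ ⟨?_, ?_⟩
    · rw [sub_nonneg, le_div_iff₀ hτ]; linarith
    · rw [sub_le_iff_le_add, div_le_iff₀ hτ]; linarith
  rw [hd, abs_mul, abs_of_pos ht, abs_of_pos (by positivity : 0 < 1 / τ)]
  have h5 : t * (1 / τ) ≤ 2 := by rw [mul_one_div, div_le_iff₀ hτ]; exact h2
  calc _ = |deriv Real.smoothTransition (t / τ - 1)| * (t * (1 / τ)) := by ring
    _ ≤ M * 2 := by gcongr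
    _ = 2 * M := by ring

lemma contDiff_rpow_mul_stepFn (hτ : 0 < τ) (s : ℝ) :
    ContDiff ℝ 1 fun t => t ^ s * stepFn τ t := by
  rw [contDiff_iff_contDiffAt]
  intro t
  rcases lt_or_ge t τ with h | h
  · have : (fun t => t ^ s * stepFn τ t) =ᶠ[𝓝 t] fun _ => 0 := by
      filter_upwards [gt_mem_nhds h] with x hx
      rw [stepFn_eq_zero hτ hx.le, mul_zero]
    exact contDiffAt_const.congr_of_eventuallyEq this
  · exact (Real.contDiffAt_rpow_const_of_ne (hτ.trans_le h).ne').mul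
      (contDiff_stepFn τ).contDiffAt

lemma hasDerivAt_rpow_mul_stepFn (hτ : 0 < τ) (s t : ℝ) :
    HasDerivAt (fun t => t ^ s * stepFn τ t)
      (s * t ^ (s - 1) * stepFn τ t + t ^ s * deriv (stepFn τ) t) t := by
  rcases lt_or_ge t τ with h | h
  · have : (fun t => t ^ s * stepFn τ t) =ᶠ[𝓝 t] fun _ => 0 := by
      filter_upwards [gt_mem_nhds h] with x hx
      rw [stepFn_eq_zero hτ hx.le, mul_zero]
    rw [stepFn_eq_zero hτ h.le, deriv_stepFn_eq_zero hτ h, mul_zero, mul_zero, add_zero]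
    exact (hasDerivAt_const t (0 : ℝ)).congr_of_eventuallyEq this
  · exact (Real.hasDerivAt_rpow_const (Or.inl (hτ.trans_le h).ne')).mul
      (((contDiff_stepFn τ).differentiable one_ne_zero t).hasDerivAt)

end Step

/-! ### Hardy's inequality along one direction -/

section LocalHardy

/-- Young's inequality by comparing `B` with `l * A`; either case leaves one of the two terms on the
right. Avoiding the conjugate exponent keeps `p = 1` included. -/
lemma mul_rpow_mul_le_add {p l A B : ℝ} (hp : 1 ≤ p) (hl : 0 < l) (hA : 0 < A) (hB : 0 ≤ B) :
    p * A ^ (p - 1) * B ≤ p * l * A ^ p + p * l ^ (1 - p) * B ^ p := by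
  have hp0 : 0 < p := by linarith
  have hAp : A ^ p = A ^ (p - 1) * A := by
    conv_rhs => rw [← Real.rpow_one A, ← Real.rpow_mul hA.le, one_mul, ← Real.rpow_add hA]
    congr 1; ring
  rcases le_total B (l * A) with h | h
  · have : p * A ^ (p - 1) * B ≤ p * A ^ (p - 1) * (l * A) := by gcongr
    have h2 : 0 ≤ p * l ^ (1 - p) * B ^ p := by positivity
    rw [hAp]; linarith
  · have hB0 : 0 < B := lt_of_lt_of_le (by positivity) h
    have h1 : A ^ (p - 1) ≤ l ^ (1 - p) * B ^ (p - 1) := by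
      have : A ≤ l⁻¹ * B := by rw [inv_mul_eq_div, le_div_iff₀ hl]; linarith
      calc A ^ (p - 1) ≤ (l⁻¹ * B) ^ (p - 1) := Real.rpow_le_rpow hA.le this (by linarith)
        _ = _ := by
          rw [Real.mul_rpow (by positivity) hB, Real.inv_rpow hl.le, ← Real.rpow_neg hl.le]
          congr 2; ring
    have hBp : B ^ p = B ^ (p - 1) * B := by
      conv_rhs => rw [← Real.rpow_one B, ← Real.rpow_mul hB, one_mul, ← Real.rpow_add hB0]
      congr 1; ring
    have h2 : 0 ≤ p * l * A ^ p := by positivity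
    calc p * A ^ (p - 1) * B ≤ p * (l ^ (1 - p) * B ^ (p - 1)) * B := by gcongr
      _ = p * l ^ (1 - p) * B ^ p := by rw [hBp]; ring
      _ ≤ _ := by linarith

lemma sqrt_sq_add_sq_rpow_le {a κ p : ℝ} (hκ : 0 < κ) (hp : 0 ≤ p) :
    √(a ^ 2 + κ ^ 2) ^ p ≤ 2 ^ p * (|a| ^ p + κ ^ p) := by
  have h1 : √(a ^ 2 + κ ^ 2) ≤ 2 * max |a| κ := by
    refine (Real.sqrt_le_left (by positivity)).2 ?_
    have h2 : a ^ 2 ≤ (max |a| κ) ^ 2 := by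
      rw [← sq_abs]; gcongr; exact le_max_left _ _
    have h3 : κ ^ 2 ≤ (max |a| κ) ^ 2 := by gcongr; exact le_max_right _ _
    nlinarith [sq_nonneg (max |a| κ)]
  have hm : (max |a| κ) ^ p ≤ |a| ^ p + κ ^ p := by
    have h2 : 0 ≤ |a| ^ p := by positivity
    have h3 : 0 ≤ κ ^ p := by positivity
    rcases max_cases |a| κ with h | h <;> rw [h.1] <;> linarith
  calc √(a ^ 2 + κ ^ 2) ^ p ≤ (2 * max |a| κ) ^ p := Real.rpow_le_rpow (by positivity) h1 hp
    _ = 2 ^ p * (max |a| κ) ^ p := Real.mul_rpow (by norm_num) (by positivity)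
    _ ≤ _ := by gcongr

lemma integral_const_mul_sub_sub_sub {α : Type*} [MeasurableSpace α] {μ : Measure α}
    {f₁ f₂ f₃ f₄ : α → ℝ} (i₁ : Integrable f₁ μ) (i₂ : Integrable f₂ μ) (i₃ : Integrable f₃ μ)
    (i₄ : Integrable f₄ μ) (c₁ c₂ c₃ c₄ : ℝ) :
    ∫ x, (c₁ * f₁ x - c₂ * f₂ x - c₃ * f₃ x - c₄ * f₄ x) ∂μ =
      c₁ * (∫ x, f₁ x ∂μ) - c₂ * (∫ x, f₂ x ∂μ) - c₃ * (∫ x, f₃ x ∂μ) -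
        c₄ * (∫ x, f₄ x ∂μ) := by
  have j₁ := i₁.const_mul c₁
  have j₂ := i₂.const_mul c₂
  have j₃ := i₃.const_mul c₃
  have j₄ := i₄.const_mul c₄
  have k₁ : Integrable (fun x => c₁ * f₁ x - c₂ * f₂ x) μ := j₁.sub j₂
  have k₂ : Integrable (fun x => c₁ * f₁ x - c₂ * f₂ x - c₃ * f₃ x) μ := k₁.sub j₃
  rw [integral_sub k₂ j₄, integral_sub k₁ j₃, integral_sub j₁ j₂]
  simp only [integral_const_mul]

set_option maxHeartbeats 800000 in
/-- Hardy's inequality along the direction `e`, for a defining function `h` with `∂ₑh = 1`. -/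
lemma hardy_directional {E : Type*} [NormedAddCommGroup E] [NormedSpace ℝ E]
    [FiniteDimensional ℝ E] [MeasurableSpace E] [BorelSpace E] (μ : Measure E)
    [μ.IsAddHaarMeasure] {h χ u : E → ℝ} {e : E} (hh : ContDiff ℝ 1 h)
    (hhe : ∀ x, fderiv ℝ h x e = 1) (hχ : ContDiff ℝ 1 χ) (hχc : HasCompactSupport χ)
    (hχ0 : ∀ x, 0 ≤ χ x) (hu : ContDiff ℝ 1 u) {s p τ : ℝ} (hs : 0 < s) (hp : 1 ≤ p)
    (hτ : 0 < τ) :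
    ENNReal.ofReal (s / 2) *
        ∫⁻ x, ENNReal.ofReal (h x ^ (s - 1) * stepFn τ (h x) * χ x * |u x| ^ p) ∂μ ≤
      ENNReal.ofReal (2 ^ p) * ∫⁻ x, ENNReal.ofReal
          (h x ^ s * stepFn τ (h x) * |fderiv ℝ χ x e| * |u x| ^ p) ∂μ +
      ENNReal.ofReal (p * (s / (2 * p)) ^ (1 - p)) * ∫⁻ x, ENNReal.ofReal
          (h x ^ (s - 1) * stepFn τ (h x) * χ x * (|h x| * |fderiv ℝ u x e|) ^ p) ∂μ := by
  have hp0 : 0 < p := by linarith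
  have hhc := hh.continuous
  have huc := hu.continuous
  have hχcont := hχ.continuous
  have hW : Continuous fun x => h x ^ (s - 1) * stepFn τ (h x) :=
    (contDiff_rpow_mul_stepFn hτ (s - 1)).continuous.comp hhc
  have hFc : Continuous fun x => h x ^ s * stepFn τ (h x) :=
    (contDiff_rpow_mul_stepFn hτ s).continuous.comp hhc
  have hW0 : ∀ x, 0 ≤ h x ^ (s - 1) * stepFn τ (h x) := fun x => by
    rcases le_or_gt (h x) τ with hx | hx
    · simp [stepFn_eq_zero hτ hx]
    · have := hτ.trans hx
      have := stepFn_nonneg τ (h x)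
      positivity
  have hdχ : Continuous fun x => fderiv ℝ χ x e :=
    (hχ.continuous_fderiv one_ne_zero).clm_apply continuous_const
  have hdu : Continuous fun x => fderiv ℝ u x e :=
    (hu.continuous_fderiv one_ne_zero).clm_apply continuous_const
  have hdχc : HasCompactSupport fun x => fderiv ℝ χ x e := by
    refine (hχc.fderiv ℝ).comp_left (g := fun L : E →L[ℝ] ℝ => L e) ?_
    simp
  set C := p * (s / (2 * p)) ^ (1 - p) with hC
  -- the three integrands
  set f₁ : E → ℝ := fun x => h x ^ (s - 1) * stepFn τ (h x) * χ x * |u x| ^ p with hf₁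
  set f₂ : E → ℝ := fun x => h x ^ s * stepFn τ (h x) * |fderiv ℝ χ x e| * |u x| ^ p with hf₂
  set f₃ : E → ℝ := fun x => h x ^ (s - 1) * stepFn τ (h x) * χ x *
    (|h x| * |fderiv ℝ u x e|) ^ p with hf₃
  set f₄ : E → ℝ := fun x => h x ^ s * stepFn τ (h x) * |fderiv ℝ χ x e| with hf₄
  have hup : Continuous fun x => |u x| ^ p := huc.abs.rpow_const fun _ => Or.inr hp0.le
  have i₁ : Integrable f₁ μ := ((hW.mul hχcont).mul hup).integrable_of_hasCompactSupport
    (hχc.mul_left.mul_right)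
  have hdχa : HasCompactSupport fun x => |fderiv ℝ χ x e| := hdχc.comp_left abs_zero
  have i₂ : Integrable f₂ μ := ((hFc.mul hdχ.abs).mul hup).integrable_of_hasCompactSupport
    (hdχa.mul_left.mul_right)
  have i₃ : Integrable f₃ μ := ((hW.mul hχcont).mul
    ((hhc.abs.mul hdu.abs).rpow_const fun _ => Or.inr hp0.le)).integrable_of_hasCompactSupport
    (hχc.mul_left.mul_right)
  have i₄ : Integrable f₄ μ := (hFc.mul hdχ.abs).integrable_of_hasCompactSupport hdχa.mul_left
  -- `|u|^p` need not be differentiable at zeros of `u` when `p = 1`, so it is replaced by `(u² +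
  -- κ²)^(p/2)`. The error carries `κ ^ p` and disappears as `κ → 0`.
  have main : ∀ κ : ℝ, 0 < κ → s / 2 * ∫ x, f₁ x ∂μ ≤ 2 ^ p * ∫ x, f₂ x ∂μ + C * ∫ x, f₃ x ∂μ +
      2 ^ p * (∫ x, f₄ x ∂μ) * κ ^ p := by
    intro κ hκ
    set M : E → ℝ := fun x => √(u x ^ 2 + κ ^ 2) with hM
    have hpos : ∀ x, 0 < u x ^ 2 + κ ^ 2 := fun x => by positivity
    have hMpos : ∀ x, 0 < M x := fun x => Real.sqrt_pos.2 (hpos x)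
    have hMC : ContDiff ℝ 1 M := ((hu.pow 2).add contDiff_const).sqrt fun x => (hpos x).ne'
    have hMu : ∀ x, |u x| ≤ M x := fun x => Real.abs_le_sqrt (by nlinarith)
    have hdM : ∀ x, |fderiv ℝ M x e| ≤ |fderiv ℝ u x e| := fun x => by
      have h1 : HasFDerivAt M ((1 / (2 * √(u x ^ 2 + κ ^ 2))) •
          ((2 * u x) • fderiv ℝ u x)) x := by
        have h2 := ((hu.differentiable one_ne_zero x).hasFDerivAt.pow 2).add_const (κ ^ 2)
        convert h2.sqrt (hpos x).ne' using 1
        simp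
      have h3 : fderiv ℝ M x e = u x / M x * fderiv ℝ u x e := by
        rw [h1.fderiv]
        simp only [_root_.smul_apply, smul_eq_mul]
        change 1 / (2 * M x) * (2 * u x * _) = _
        have := (hMpos x).ne'
        field_simp
      rw [h3, abs_mul, abs_div, abs_of_pos (hMpos x)]
      exact mul_le_of_le_one_left (abs_nonneg _) ((div_le_one (hMpos x)).2 (hMu x))
    set Ψ : E → ℝ := fun x => M x ^ p with hΨ
    have hΨC : ContDiff ℝ 1 Ψ := hMC.rpow_const_of_ne fun x => (hMpos x).ne'
    have hdΨ : ∀ x, fderiv ℝ Ψ x e = p * M x ^ (p - 1) * fderiv ℝ M x e := fun x => by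
      have h1 := (hMC.differentiable one_ne_zero x).hasFDerivAt.rpow_const (p := p)
        (Or.inl (hMpos x).ne')
      rw [h1.fderiv]; simp
    set f : E → ℝ := fun x => h x ^ s * stepFn τ (h x) * χ x with hf
    have hFC : ContDiff ℝ 1 fun x => h x ^ s * stepFn τ (h x) :=
      (contDiff_rpow_mul_stepFn hτ s).comp hh
    have hfC : ContDiff ℝ 1 f := hFC.mul hχ
    have hfc : HasCompactSupport f := hχc.mul_left
    have hdf : ∀ x, fderiv ℝ f x e = (s * h x ^ (s - 1) * stepFn τ (h x) +
        h x ^ s * deriv (stepFn τ) (h x)) * χ x +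
        h x ^ s * stepFn τ (h x) * fderiv ℝ χ x e := fun x => by
      have h1 := (hasDerivAt_rpow_mul_stepFn hτ s (h x)).comp_hasFDerivAt x
        (hh.differentiable one_ne_zero x).hasFDerivAt
      have h2 := h1.mul (hχ.differentiable one_ne_zero x).hasFDerivAt
      have h3 : fderiv ℝ f x = _ := h2.fderiv
      rw [h3]
      simp [hhe]
      ring
    have hdfcont : Continuous fun x => fderiv ℝ f x e :=
      (hfC.continuous_fderiv one_ne_zero).clm_apply continuous_const
    have hdΨcont : Continuous fun x => fderiv ℝ Ψ x e :=
      (hΨC.continuous_fderiv one_ne_zero).clm_apply continuous_const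
    have hdfc : HasCompactSupport fun x => fderiv ℝ f x e := by
      refine (hfc.fderiv ℝ).comp_left (g := fun L : E →L[ℝ] ℝ => L e) ?_
      simp
    have j1 : Integrable (fun x => fderiv ℝ f x e * Ψ x) μ :=
      (hdfcont.mul hΨC.continuous).integrable_of_hasCompactSupport hdfc.mul_right
    have j2 : Integrable (fun x => f x * fderiv ℝ Ψ x e) μ :=
      (hfC.continuous.mul hdΨcont).integrable_of_hasCompactSupport hfc.mul_right
    have hibp := integral_mul_fderiv_eq_neg_fderiv_mul_of_integrable (μ := μ) (v := e) j1 j2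
      ((hfC.continuous.mul hΨC.continuous).integrable_of_hasCompactSupport hfc.mul_right)
      (fun x _ => hfC.differentiable one_ne_zero x) (fun x _ => hΨC.differentiable one_ne_zero x)
    -- The right side is the integrand of `∫ ∂ₑ(f Ψ) = 0`. The term with the derivative of the step
    -- is nonnegative and can be discarded.
    have hptw : ∀ x, s / 2 * f₁ x - 2 ^ p * f₂ x - C * f₃ x - 2 ^ p * κ ^ p * f₄ x ≤
        fderiv ℝ f x e * Ψ x + f x * fderiv ℝ Ψ x e := by
      intro x
      -- Below `τ` everything vanishes; at `h x = τ` the sign of the step's derivative suffices.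
      rcases le_or_gt (h x) τ with hx | hx
      · have hz := stepFn_eq_zero hτ hx
        have h0 : h x ^ s * deriv (stepFn τ) (h x) * χ x * Ψ x ≥ 0 := by
          rcases hx.lt_or_eq with hx' | hx'
          · simp [deriv_stepFn_eq_zero hτ hx']
          · have := deriv_stepFn_nonneg hτ (h x)
            have := hχ0 x
            have h1 : 0 < h x := by rw [hx']; exact hτ
            have h2 : 0 ≤ Ψ x := Real.rpow_nonneg (hMpos x).le _
            positivity
        rw [hdf]
        simp only [hf₁, hf₂, hf₃, hf₄, hf, hz]
        simp only [mul_zero, zero_mul, sub_zero, zero_add, add_zero]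
        exact h0
      · have hx0 : 0 < h x := hτ.trans hx
        set W := h x ^ (s - 1) * stepFn τ (h x) with hWd
        have hWx : 0 ≤ W := hW0 x
        have hFW : h x ^ s = h x ^ (s - 1) * h x := by
          conv_rhs => rw [← Real.rpow_one (h x), ← Real.rpow_mul hx0.le, one_mul,
            ← Real.rpow_add hx0]
          congr 1; ring
        have hχx := hχ0 x
        have hΨl : |u x| ^ p ≤ Ψ x := Real.rpow_le_rpow (abs_nonneg _) (hMu x) hp0.le
        have hΨu : Ψ x ≤ 2 ^ p * (|u x| ^ p + κ ^ p) := sqrt_sq_add_sq_rpow_le hκ hp0.le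
        have hΨ0 : 0 ≤ Ψ x := Real.rpow_nonneg (hMpos x).le _
        -- With `l = s / (2 * p)` the cross term consumes exactly half of the main term `s * W * χ *
        -- Ψ`.
        have hy := mul_rpow_mul_le_add (l := s / (2 * p)) (A := M x)
          (B := h x * |fderiv ℝ u x e|) hp (by positivity) (hMpos x) (by positivity)
        have hps : p * (s / (2 * p)) = s / 2 := by field_simp
        rw [hps, ← hC] at hy
        have hMp : 0 ≤ p * M x ^ (p - 1) := mul_nonneg hp0.le (Real.rpow_nonneg (hMpos x).le _)
        have hcross : -(s / 2 * (W * χ x * Ψ x) + C * f₃ x) ≤ f x * fderiv ℝ Ψ x e := by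
          have e1 : f x * fderiv ℝ Ψ x e =
              W * χ x * (p * M x ^ (p - 1) * (h x * fderiv ℝ M x e)) := by
            rw [hdΨ, hf]; simp only [hFW, hWd]; ring
          have e2 : f₃ x = W * χ x * (h x * |fderiv ℝ u x e|) ^ p := by
            simp only [hf₃, abs_of_pos hx0, hWd]
          rw [e1, e2]
          have h1 : -(p * M x ^ (p - 1) * (h x * |fderiv ℝ u x e|)) ≤
              p * M x ^ (p - 1) * (h x * fderiv ℝ M x e) := by
            rw [neg_le_iff_add_nonneg, ← mul_add, ← mul_add]
            refine mul_nonneg hMp (mul_nonneg hx0.le ?_)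
            have := neg_abs_le (fderiv ℝ M x e)
            linarith [hdM x]
          have h2 : 0 ≤ W * χ x := mul_nonneg hWx hχx
          have h3 := mul_le_mul_of_nonneg_left hy h2
          have h4 := mul_le_mul_of_nonneg_left h1 h2
          simp only [hΨ]
          nlinarith
        have hpart : s * (W * χ x * Ψ x) - f₄ x * Ψ x ≤ fderiv ℝ f x e * Ψ x := by
          rw [hdf]
          have h1 : 0 ≤ h x ^ s * deriv (stepFn τ) (h x) * χ x * Ψ x := by
            have := deriv_stepFn_nonneg hτ (h x)
            positivity
          have hF0 : 0 ≤ h x ^ s * stepFn τ (h x) := by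
            have := stepFn_nonneg τ (h x); positivity
          have h2 : -(f₄ x * Ψ x) ≤ h x ^ s * stepFn τ (h x) * fderiv ℝ χ x e * Ψ x := by
            simp only [hf₄]
            rw [neg_le_iff_add_nonneg, ← add_mul, ← mul_add]
            refine mul_nonneg (mul_nonneg hF0 ?_) hΨ0
            linarith [neg_abs_le (fderiv ℝ χ x e)]
          simp only [hWd]
          nlinarith
        have hf4 : 0 ≤ f₄ x := by
          have := stepFn_nonneg τ (h x); simp only [hf₄]; positivity
        have h5 : f₄ x * Ψ x ≤ 2 ^ p * f₂ x + 2 ^ p * κ ^ p * f₄ x := by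
          have := mul_le_mul_of_nonneg_left hΨu hf4
          have e3 : f₂ x = f₄ x * |u x| ^ p := rfl
          rw [e3]; linarith
        have h6 : f₁ x ≤ W * χ x * Ψ x := mul_le_mul_of_nonneg_left hΨl (mul_nonneg hWx hχx)
        have h7 : s / 2 * f₁ x ≤ s / 2 * (W * χ x * Ψ x) := by gcongr
        linarith
    have hint := integral_mono (((((i₁.const_mul (s / 2)).sub (i₂.const_mul (2 ^ p))).sub
      (i₃.const_mul C)).sub (i₄.const_mul (2 ^ p * κ ^ p)))) (j1.add j2) hptw
    simp only [Pi.add_apply] at hint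
    rw [integral_add j1 j2, hibp, add_neg_cancel] at hint
    have e5 : ∫ x, (s / 2 * f₁ x - 2 ^ p * f₂ x - C * f₃ x - 2 ^ p * κ ^ p * f₄ x) ∂μ =
        s / 2 * (∫ x, f₁ x ∂μ) - 2 ^ p * (∫ x, f₂ x ∂μ) - C * (∫ x, f₃ x ∂μ) -
        2 ^ p * κ ^ p * (∫ x, f₄ x ∂μ) :=
      integral_const_mul_sub_sub_sub i₁ i₂ i₃ i₄ _ _ _ _
    have hint' := e5.symm.le.trans hint
    linarith
  have hlim : Tendsto (fun κ : ℝ => 2 ^ p * ∫ x, f₂ x ∂μ + C * ∫ x, f₃ x ∂μ +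
      2 ^ p * (∫ x, f₄ x ∂μ) * κ ^ p) (𝓝[>] 0) (𝓝 (2 ^ p * ∫ x, f₂ x ∂μ + C * ∫ x, f₃ x ∂μ +
      2 ^ p * (∫ x, f₄ x ∂μ) * 0)) := by
    refine tendsto_const_nhds.add (tendsto_const_nhds.mul ?_)
    have := (Real.continuous_rpow_const hp0.le).tendsto 0
    rw [Real.zero_rpow hp0.ne'] at this
    exact this.mono_left nhdsWithin_le_nhds
  have := ge_of_tendsto hlim (by filter_upwards [self_mem_nhdsWithin] with κ hκ using main κ hκ)
  rw [mul_zero, add_zero] at this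
  have hF0 : ∀ x, 0 ≤ h x ^ s * stepFn τ (h x) := fun x => by
    rcases le_or_gt (h x) τ with hx | hx
    · simp [stepFn_eq_zero hτ hx]
    · have := hτ.trans hx
      have := stepFn_nonneg τ (h x)
      positivity
  have n₁ : ∀ x, 0 ≤ f₁ x := fun x => by
    have := hW0 x; have := hχ0 x; simp only [hf₁]; positivity
  have n₂ : ∀ x, 0 ≤ f₂ x := fun x => by
    have := hF0 x; simp only [hf₂]; positivity
  have n₃ : ∀ x, 0 ≤ f₃ x := fun x => by
    have := hW0 x; have := hχ0 x; simp only [hf₃]; positivity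
  rw [← ofReal_integral_eq_lintegral_ofReal i₁ (Eventually.of_forall n₁),
    ← ofReal_integral_eq_lintegral_ofReal i₂ (Eventually.of_forall n₂),
    ← ofReal_integral_eq_lintegral_ofReal i₃ (Eventually.of_forall n₃),
    ← ENNReal.ofReal_mul (by positivity), ← ENNReal.ofReal_mul (by positivity),
    ← ENNReal.ofReal_mul (by positivity), ← ENNReal.ofReal_add
      (mul_nonneg (by positivity) (integral_nonneg n₂))
      (mul_nonneg (by positivity) (integral_nonneg n₃))]
  exact ENNReal.ofReal_le_ofReal this

end LocalHardy

/-! ### Boundary charts -/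

section Chart

variable {n : ℕ} {ω : Set (EucSp n)}

/-- Near a boundary point of a `C²` set there is a defining function with unit derivative in some
direction, comparable to the distance to the complement. -/
lemma exists_definingFunction (hω : IsOpen ω) (hC2 : IsClassC2 ω) {x₀ : EucSp n}
    (hx₀ : x₀ ∈ frontier ω) :
    ∃ (e : EucSp n) (h : EucSp n → ℝ) (ρ L : ℝ), ‖e‖ = 1 ∧ ContDiff ℝ 1 h ∧
      (∀ x, fderiv ℝ h x e = 1) ∧ 0 < ρ ∧ 1 ≤ L ∧
      ∀ x ∈ ball x₀ ρ, (x ∈ ω ↔ 0 < h x) ∧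
        (x ∈ ω → infDist x ωᶜ ≤ h x ∧ h x ≤ L * infDist x ωᶜ) := by
  obtain ⟨e, γ, r, he, hγ, hr, hchart⟩ := hC2 x₀ hx₀
  set P := (Submodule.span ℝ {e})ᗮ.orthogonalProjectionOnto with hP
  have hPe : P e = 0 := by
    rw [hP, Submodule.orthogonalProjectionOnto_eq_zero_iff, Submodule.orthogonal_orthogonal]
    exact Submodule.mem_span_singleton_self e
  set h : EucSp n → ℝ := fun x => inner ℝ e x - γ (P x) with hh
  have hiff : ∀ x ∈ ball x₀ r, (x ∈ ω ↔ 0 < h x) := fun x hx => by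
    rw [hchart x hx, hh, sub_pos]
  have hC : ContDiff ℝ 1 h :=
    (contDiff_const.inner ℝ contDiff_id).sub
      ((hγ.of_le (by norm_num)).comp P.contDiff)
  have hhe : ∀ x, fderiv ℝ h x e = 1 := fun x => by
    have h1 : HasFDerivAt (fun x => γ (P x)) ((fderiv ℝ γ (P x)).comp P) x :=
      ((hγ.differentiable (by norm_num) (P x)).hasFDerivAt).comp x P.hasFDerivAt
    have h2 : HasFDerivAt (fun x : EucSp n => inner ℝ e x) (innerSL ℝ e) x :=
      (innerSL ℝ e).hasFDerivAt
    rw [show fderiv ℝ h x = _ from (h2.sub h1).fderiv]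
    simp [hPe, he]
  -- Moving along `-e` lowers `h` at unit speed, so `x - h x • e` is on the zero level, outside `ω`,
  -- at distance `h x`. This gives `infDist x ωᶜ ≤ h x`; the converse bound is the Lipschitz
  -- property at a nearest point of the complement.
  have hshift : ∀ x t, h (x - t • e) = h x - t := fun x t => by
    simp [hh, hPe, inner_sub_right, inner_smul_right, he]
    ring
  have hx₀ω : x₀ ∉ ω := by rw [hω.frontier_eq] at hx₀; exact hx₀.2
  have hx₀0 : h x₀ = 0 := by
    refine le_antisymm (not_lt.1 fun hc => hx₀ω ((hiff x₀ (mem_ball_self hr)).2 hc)) ?_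
    by_contra hc
    push Not at hc
    have hev : ∀ᶠ x in 𝓝 x₀, h x < 0 ∧ x ∈ ball x₀ r :=
      (hC.continuous.continuousAt.eventually (gt_mem_nhds hc)).and (ball_mem_nhds _ hr)
    obtain ⟨x, hxω, hx⟩ := ((mem_closure_iff_frequently.1 hx₀.1).and_eventually hev).exists
    have := (hiff x hx.2).1 hxω
    linarith [hx.1]
  obtain ⟨K, t, ht, hK⟩ := (hC.contDiffAt (x := x₀)).exists_lipschitzOnWith
  obtain ⟨r₁, hr₁, hr₁t⟩ := Metric.mem_nhds_iff.1 (inter_mem ht (ball_mem_nhds x₀ hr))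
  set L : ℝ := max 1 K with hL
  have hL1 : 1 ≤ L := le_max_left _ _
  have hLip : ∀ x ∈ ball x₀ r₁, ∀ y ∈ ball x₀ r₁, |h x - h y| ≤ L * dist x y := by
    intro x hx y hy
    refine (hK.dist_le_mul x (hr₁t hx).1 y (hr₁t hy).1).trans ?_
    gcongr
    exact le_max_right _ _
  -- Small enough that both the shifted point, within `(1 + L) * ρ` of `x₀`, and the nearest
  -- complement point, within `2 * ρ`, remain in the ball of radius `r₁`.
  set ρ := r₁ / (2 * (1 + L)) with hρ
  have hρ0 : 0 < ρ := by positivity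
  have hρr : ρ * (2 * (1 + L)) = r₁ := by rw [hρ]; field_simp
  have hρr1 : 2 * ρ ≤ r₁ := by nlinarith
  refine ⟨e, h, ρ, L, he, hC, hhe, hρ0, hL1, fun x hx => ?_⟩
  have hxr₁ : x ∈ ball x₀ r₁ := ball_subset_ball (by linarith) hx
  refine ⟨hiff x (hr₁t hxr₁).2, fun hxω => ?_⟩
  have hpos : 0 < h x := (hiff x (hr₁t hxr₁).2).1 hxω
  rw [mem_ball] at hx
  constructor
  · have hle : h x ≤ L * dist x x₀ := by
      have := hLip x hxr₁ x₀ (mem_ball_self hr₁)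
      rw [hx₀0, sub_zero] at this
      exact (le_abs_self _).trans this
    have hdist : dist x (x - h x • e) = h x := by
      rw [dist_self_sub_right, norm_smul, he, mul_one, Real.norm_of_nonneg hpos.le]
    have hy : x - h x • e ∉ ω := fun hc => by
      have hyr : x - h x • e ∈ ball x₀ r₁ := by
        rw [mem_ball]
        have h1 := dist_triangle (x - h x • e) x x₀
        rw [dist_comm (x - h x • e) x, hdist] at h1
        nlinarith
      have := (hiff _ (hr₁t hyr).2).1 hc
      rw [hshift, sub_self] at this
      exact lt_irrefl _ this
    rw [← hdist]
    exact infDist_le_dist_of_mem hy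
  · obtain ⟨y, hyω, hy⟩ := hω.isClosed_compl.exists_infDist_eq_dist ⟨x₀, hx₀ω⟩ x
    have hle : infDist x ωᶜ ≤ dist x x₀ := infDist_le_dist_of_mem hx₀ω
    have hyr : y ∈ ball x₀ r₁ := by
      rw [mem_ball]
      have h1 := dist_triangle y x x₀
      rw [dist_comm y x, ← hy] at h1
      linarith
    have hy0 : h y ≤ 0 := not_lt.1 fun hc => hyω ((hiff y (hr₁t hyr).2).2 hc)
    rw [hy]
    have := (le_abs_self _).trans (hLip x hxr₁ y hyr)
    linarith

/-- The step is placed at height `L * τ` of `h`. As `h ≤ L * d`, its support within the chart lies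
in `{d > τ}`; as `d ≤ h`, it equals 1 where `d > 2 * (L * τ)`. The two-sided comparison of `h` with
`d` then exchanges the weights. -/
lemma hardy_boundary_chart (hω : IsOpen ω) (hC2 : IsClassC2 ω) {x₀ : EucSp n}
    (hx₀ : x₀ ∈ frontier ω) {b p : ℝ} (hb : -1 < b) (hp : 1 ≤ p) :
    ∃ (ρ L : ℝ) (C : ℝ≥0), 0 < ρ ∧ 1 ≤ L ∧ ∀ τ, 0 < τ → ∀ u : EucSp n → ℝ, ContDiff ℝ 1 u →
      wInt ω (ball x₀ ρ ∩ {x | 2 * (L * τ) < infDist x ωᶜ}) b p u ≤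
        C * wInt ω {x | τ < infDist x ωᶜ} (b + 1) p u +
        C * wInt ω {x | τ < infDist x ωᶜ} (b + p) p (fderiv ℝ u) := by
  obtain ⟨e, h, ρ, L, he, hC, hhe, hρ, hL, hh⟩ := exists_definingFunction hω hC2 hx₀
  have hc : ωᶜ.Nonempty := ⟨x₀, by rw [hω.frontier_eq] at hx₀; exact hx₀.2⟩
  have hp0 : 0 < p := by linarith
  have hL0 : 0 < L := by linarith
  set s := b + 1 with hs
  have hs0 : 0 < s := by linarith
  let φ : ContDiffBump x₀ := ⟨ρ / 4, ρ / 2, by positivity, by linarith⟩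
  have hφc : ContDiff ℝ 1 φ := φ.contDiff
  have hts : tsupport φ ⊆ ball x₀ ρ := by
    rw [φ.tsupport_eq]; exact closedBall_subset_ball (half_lt_self hρ)
  obtain ⟨M, hM⟩ := (φ.hasCompactSupport.fderiv ℝ).exists_bound_of_continuous
    (hφc.continuous_fderiv one_ne_zero)
  have hM0 : 0 ≤ M := (norm_nonneg _).trans (hM x₀)
  set C₀ := p * (s / (2 * p)) ^ (1 - p) with hC₀
  set A := 2 / s * L ^ |b| * max (2 ^ p * (L ^ s * M)) (C₀ * L ^ (b + p)) with hA
  have hA0 : 0 ≤ A := by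
    have : 0 ≤ 2 ^ p * (L ^ s * M) := by positivity
    have := le_max_of_le_left (c := C₀ * L ^ (b + p)) this
    positivity
  refine ⟨ρ / 4, L, A.toNNReal, by positivity, hL, fun τ hτ u hu => ?_⟩
  have hLτ : 0 < L * τ := by positivity
  have H := hardy_directional (volume : Measure (EucSp n)) hC hhe hφc φ.hasCompactSupport
    (fun x => φ.nonneg) hu hs0 hp hLτ
  rw [← hC₀] at H
  set U := {x | τ < infDist x ωᶜ} with hU
  have hUm : MeasurableSet U := measurableSet_lt_infDist ω τ
  have hnz : ∀ x ∈ tsupport φ, stepFn (L * τ) (h x) ≠ 0 →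
      0 < infDist x ωᶜ ∧ x ∈ U ∧ 0 < h x ∧ h x ≤ L * infDist x ωᶜ := by
    intro x hx hst
    have hlt : L * τ < h x := by
      by_contra hcon
      exact hst (stepFn_eq_zero hLτ (not_lt.1 hcon))
    have hpos : 0 < h x := hLτ.trans hlt
    have hxω := ((hh x (hts hx)).1).2 hpos
    have h2 := ((hh x (hts hx)).2 hxω).2
    refine ⟨(infDist_compl_pos_iff hω hc).2 hxω, ?_, hpos, h2⟩
    exact lt_of_mul_lt_mul_left (hlt.trans_le h2) hL0.le
  have conv : ∀ (β c : ℝ) {F : Type} [NormedAddCommGroup F] (w : EucSp n → F), 0 ≤ c → ∀ x ∈ U,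
      ENNReal.ofReal (c * (infDist x ωᶜ ^ β * ‖w x‖ ^ p)) =
        ENNReal.ofReal c * (ENNReal.ofReal (infDist x ωᶜ ^ β) * ‖w x‖ₑ ^ p) := by
    intro β c F _ w hc0 x hx
    have : 0 ≤ infDist x ωᶜ ^ β := Real.rpow_nonneg infDist_nonneg _
    rw [ENNReal.ofReal_mul hc0, ENNReal.ofReal_mul this, ← ofReal_norm,
      ENNReal.ofReal_rpow_of_nonneg (norm_nonneg _) hp0.le]
  -- upper bounds
  have up : ∀ (β c : ℝ) {F : Type} [NormedAddCommGroup F] (w : EucSp n → F) (f : EucSp n → ℝ),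
      0 ≤ c → (∀ x ∉ U, f x ≤ 0) → (∀ x ∈ U, f x ≤ c * (infDist x ωᶜ ^ β * ‖w x‖ ^ p)) →
      ∫⁻ x, ENNReal.ofReal (f x) ≤ ENNReal.ofReal c * wInt ω U β p w := by
    intro β c F _ w f hc0 h1 h2
    rw [wInt, ← lintegral_const_mul' _ _ ENNReal.ofReal_ne_top, ← lintegral_indicator hUm]
    refine lintegral_mono fun x => ?_
    by_cases hx : x ∈ U
    · rw [indicator_of_mem hx, ← conv β c w hc0 x hx]
      exact ENNReal.ofReal_le_ofReal (h2 x hx)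
    · rw [indicator_of_notMem hx, ENNReal.ofReal_of_nonpos (h1 x hx)]
  have hdist0 : ∀ x ∈ U, 0 < infDist x ωᶜ := fun x hx => hτ.trans hx
  have u₂ := up s (L ^ s * M) u
    (fun x => h x ^ s * stepFn (L * τ) (h x) * |fderiv ℝ φ x e| * |u x| ^ p) (by positivity)
    (fun x hx => by
      by_cases h0 : stepFn (L * τ) (h x) = 0
      · simp [h0]
      by_cases h1 : x ∈ tsupport φ
      · exact absurd (hnz x h1 h0).2.1 hx
      · rw [fderiv_of_notMem_tsupport ℝ h1]; simp)
    (fun x hx => by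
      have hd := hdist0 x hx
      have hr0 : 0 ≤ L ^ s * M * (infDist x ωᶜ ^ s * ‖u x‖ ^ p) := by positivity
      by_cases h0 : stepFn (L * τ) (h x) = 0
      · simpa [h0] using hr0
      by_cases h1 : x ∈ tsupport φ
      · obtain ⟨-, -, h3, h4⟩ := hnz x h1 h0
        have h5 : h x ^ s ≤ L ^ s * infDist x ωᶜ ^ s := by
          rw [← Real.mul_rpow hL0.le hd.le]
          exact Real.rpow_le_rpow h3.le h4 hs0.le
        have h6 : |fderiv ℝ φ x e| ≤ M := by
          refine ((fderiv ℝ φ x).le_opNorm e).trans ?_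
          rw [he, mul_one]; exact hM x
        have h7 := stepFn_le_one (L * τ) (h x)
        have h8 := stepFn_nonneg (L * τ) (h x)
        calc h x ^ s * stepFn (L * τ) (h x) * |fderiv ℝ φ x e| * |u x| ^ p
            ≤ L ^ s * infDist x ωᶜ ^ s * 1 * M * |u x| ^ p := by gcongr
          _ = _ := by rw [Real.norm_eq_abs]; ring
      · rw [fderiv_of_notMem_tsupport ℝ h1]; simpa using hr0)
  have u₃ := up (b + p) (L ^ (b + p)) (fderiv ℝ u)
    (fun x => h x ^ (s - 1) * stepFn (L * τ) (h x) * φ x * (|h x| * |fderiv ℝ u x e|) ^ p)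
    (by positivity)
    (fun x hx => by
      by_cases h0 : stepFn (L * τ) (h x) = 0
      · simp [h0]
      by_cases h1 : x ∈ tsupport φ
      · exact absurd (hnz x h1 h0).2.1 hx
      · rw [image_eq_zero_of_notMem_tsupport h1]; simp)
    (fun x hx => by
      have hd := hdist0 x hx
      have hr0 : 0 ≤ L ^ (b + p) * (infDist x ωᶜ ^ (b + p) * ‖fderiv ℝ u x‖ ^ p) := by positivity
      by_cases h0 : stepFn (L * τ) (h x) = 0
      · simpa [h0] using hr0
      by_cases h1 : x ∈ tsupport φ
      · obtain ⟨-, -, h3, h4⟩ := hnz x h1 h0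
        have h5 : h x ^ (s - 1) * h x ^ p ≤ L ^ (b + p) * infDist x ωᶜ ^ (b + p) := by
          rw [← Real.mul_rpow hL0.le hd.le, ← Real.rpow_add h3,
            show s - 1 + p = b + p by rw [hs]; ring]
          exact Real.rpow_le_rpow h3.le h4 (by linarith)
        have h6 : |fderiv ℝ u x e| ≤ ‖fderiv ℝ u x‖ := by
          refine ((fderiv ℝ u x).le_opNorm e).trans ?_
          rw [he, mul_one]
        have h7 := stepFn_le_one (L * τ) (h x)
        have h8 := stepFn_nonneg (L * τ) (h x)
        have h9 : φ x ≤ 1 := φ.le_one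
        have h10 : 0 ≤ φ x := φ.nonneg
        rw [abs_of_pos h3, Real.mul_rpow h3.le (abs_nonneg _)]
        calc h x ^ (s - 1) * stepFn (L * τ) (h x) * φ x * (h x ^ p * |fderiv ℝ u x e| ^ p)
            = (h x ^ (s - 1) * h x ^ p) * stepFn (L * τ) (h x) * φ x * |fderiv ℝ u x e| ^ p := by
              ring
          _ ≤ L ^ (b + p) * infDist x ωᶜ ^ (b + p) * 1 * 1 * ‖fderiv ℝ u x‖ ^ p := by gcongr
          _ = _ := by ring
      · rw [image_eq_zero_of_notMem_tsupport h1]; simpa using hr0)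
  -- lower bound
  have hSm : MeasurableSet (ball x₀ (ρ / 4) ∩ {x | 2 * (L * τ) < infDist x ωᶜ}) :=
    measurableSet_ball.inter (measurableSet_lt_infDist ω _)
  have low : wInt ω (ball x₀ (ρ / 4) ∩ {x | 2 * (L * τ) < infDist x ωᶜ}) b p u ≤
      ENNReal.ofReal (L ^ |b|) * ∫⁻ x, ENNReal.ofReal
        (h x ^ (s - 1) * stepFn (L * τ) (h x) * φ x * |u x| ^ p) := by
    rw [← lintegral_const_mul' _ _ ENNReal.ofReal_ne_top]
    refine (setLIntegral_mono' hSm fun x hx => ?_).trans (setLIntegral_le_lintegral _ _)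
    have hxd : 2 * (L * τ) < infDist x ωᶜ := hx.2
    have hd0 : 0 < infDist x ωᶜ := by linarith
    have hxω := (infDist_compl_pos_iff hω hc).1 hd0
    have hxb : x ∈ ball x₀ ρ := ball_subset_ball (by linarith) hx.1
    obtain ⟨h1, h2⟩ := (hh x hxb).2 hxω
    have h3 : 0 < h x := hd0.trans_le h1
    have hU' : x ∈ U := by
      change τ < _
      nlinarith
    have hφ1 : φ x = 1 := φ.one_of_mem_closedBall (ball_subset_closedBall hx.1)
    have hcv := conv b 1 u zero_le_one x hU'
    rw [ENNReal.ofReal_one, one_mul, one_mul] at hcv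
    rw [← hcv, ← ENNReal.ofReal_mul (by positivity), hφ1, stepFn_eq_one hLτ (by linarith)]
    refine ENNReal.ofReal_le_ofReal ?_
    have h4 := rpow_le_rpow_abs_mul hL0 hd0 h3 (by nlinarith) h2 b
    rw [show s - 1 = b by rw [hs]; ring, mul_one, mul_one, Real.norm_eq_abs, ← mul_assoc]
    gcongr
  have hs2 : ENNReal.ofReal (2 / s) * ENNReal.ofReal (s / 2) = 1 := by
    rw [← ENNReal.ofReal_mul (by positivity), ← ENNReal.ofReal_one]
    congr 1; field_simp
  have hC₀0 : 0 ≤ C₀ := by positivity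
  set X := wInt ω U s p u
  set Y := wInt ω U (b + p) p (fderiv ℝ u)
  have hmax1 : ENNReal.ofReal (2 ^ p) * ENNReal.ofReal (L ^ s * M) ≤
      ENNReal.ofReal (max (2 ^ p * (L ^ s * M)) (C₀ * L ^ (b + p))) := by
    rw [← ENNReal.ofReal_mul (by positivity)]
    exact ENNReal.ofReal_le_ofReal (le_max_left _ _)
  have hmax2 : ENNReal.ofReal C₀ * ENNReal.ofReal (L ^ (b + p)) ≤
      ENNReal.ofReal (max (2 ^ p * (L ^ s * M)) (C₀ * L ^ (b + p))) := by
    rw [← ENNReal.ofReal_mul hC₀0]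
    exact ENNReal.ofReal_le_ofReal (le_max_right _ _)
  set mx := max (2 ^ p * (L ^ s * M)) (C₀ * L ^ (b + p)) with hmx
  calc wInt ω (ball x₀ (ρ / 4) ∩ {x | 2 * (L * τ) < infDist x ωᶜ}) b p u
      ≤ ENNReal.ofReal (L ^ |b|) * ∫⁻ x, ENNReal.ofReal
        (h x ^ (s - 1) * stepFn (L * τ) (h x) * φ x * |u x| ^ p) := low
    _ = ENNReal.ofReal (L ^ |b|) * (ENNReal.ofReal (2 / s) * (ENNReal.ofReal (s / 2) *
        ∫⁻ x, ENNReal.ofReal (h x ^ (s - 1) * stepFn (L * τ) (h x) * φ x * |u x| ^ p))) := by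
        rw [← mul_assoc (ENNReal.ofReal (2 / s)), hs2, one_mul]
    _ ≤ ENNReal.ofReal (L ^ |b|) * (ENNReal.ofReal (2 / s) *
        (ENNReal.ofReal (2 ^ p) * (ENNReal.ofReal (L ^ s * M) * X) +
          ENNReal.ofReal C₀ * (ENNReal.ofReal (L ^ (b + p)) * Y))) := by
        gcongr
        exact H.trans (by gcongr)
    _ ≤ ENNReal.ofReal (L ^ |b|) * (ENNReal.ofReal (2 / s) *
        (ENNReal.ofReal mx * X + ENNReal.ofReal mx * Y)) := by
        rw [← mul_assoc (ENNReal.ofReal (2 ^ p)), ← mul_assoc (ENNReal.ofReal C₀)]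
        gcongr
    _ = ENNReal.ofReal A * X + ENNReal.ofReal A * Y := by
        rw [hA, ENNReal.ofReal_mul (by positivity), ENNReal.ofReal_mul (by positivity)]
        ring

end Chart

/-! ### The global weighted Hardy inequality -/

section GlobalHardy

variable {n : ℕ} {ω : Set (EucSp n)}

lemma wInt_union_le {F : Type*} [NormedAddCommGroup F] (S T : Set (EucSp n)) (β q : ℝ)
    (f : EucSp n → F) : wInt ω (S ∪ T) β q f ≤ wInt ω S β q f + wInt ω T β q f :=
  lintegral_union_le _ _ _

/-- Compactness of `closure ω` reduces the claim to neighbourhoods. Near a point of `ω`, `d` is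
bounded below, so `d^b` is at most a multiple of `d^(b+1)`; near a frontier point the chart estimate
applies. -/
lemma hardy_gain_one (hn : 0 < n) (hω : IsOpen ω) (hbd : Bornology.IsBounded ω)
    (hC2 : IsClassC2 ω) {b p : ℝ} (hb : -1 < b) (hp : 1 ≤ p) :
    ∃ C : ℝ≥0, ∀ (v : EucSp n → ℝ) (g : EucSp n → EucSp n), IsSobolevW1 p ω v g →
      wInt ω ω b p v ≤ C * wInt ω ω (b + 1) p v + C * wInt ω ω (b + p) p g := by
  have hc := compl_nonempty_of_isBounded hn hbd
  have key : ∃ C : ℝ≥0, ∀ (v : EucSp n → ℝ) (g : EucSp n → EucSp n), IsSobolevW1 p ω v g →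
      wInt ω (closure ω ∩ ω) b p v ≤ C * wInt ω ω (b + 1) p v + C * wInt ω ω (b + p) p g := by
    refine hbd.isCompact_closure.induction_on (p := fun S => ∃ C : ℝ≥0, ∀ (v : EucSp n → ℝ)
      (g : EucSp n → EucSp n), IsSobolevW1 p ω v g → wInt ω (S ∩ ω) b p v ≤
        C * wInt ω ω (b + 1) p v + C * wInt ω ω (b + p) p g) ?_ ?_ ?_ ?_
    · exact ⟨0, fun v g _ => by simp [wInt]⟩
    · rintro S T hST ⟨C, hC⟩
      exact ⟨C, fun v g h => (wInt_mono_set (inter_subset_inter_left _ hST) _ _ _).trans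
        (hC v g h)⟩
    · rintro S T ⟨C, hC⟩ ⟨C', hC'⟩
      refine ⟨C + C', fun v g h => ?_⟩
      rw [union_inter_distrib_right]
      refine (wInt_union_le _ _ _ _ _).trans ((add_le_add (hC v g h) (hC' v g h)).trans_eq ?_)
      push_cast
      ring
    · intro x hx
      by_cases hxω : x ∈ ω
      · have hd := (infDist_compl_pos_iff hω hc).2 hxω
        refine ⟨{y | infDist x ωᶜ / 2 < infDist y ωᶜ}, mem_nhdsWithin_of_mem_nhds
          ((isOpen_lt continuous_const (continuous_infDist_pt _)).mem_nhds (half_lt_self hd)),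
          (2 / infDist x ωᶜ).toNNReal, fun v g _ => ?_⟩
        refine le_add_right ((wInt_le_mul_wInt
          ((measurableSet_lt_infDist ω _).inter hω.measurableSet) (by positivity)
          (fun y hy => ?_) p v).trans (mul_le_mul_right (wInt_mono_set inter_subset_right _ _ _) _))
        have hy1 : infDist x ωᶜ / 2 < infDist y ωᶜ := hy.1
        have hy0 : 0 < infDist y ωᶜ := by linarith
        rw [Real.rpow_add hy0, Real.rpow_one, mul_comm (infDist y ωᶜ ^ b), ← mul_assoc]
        refine le_mul_of_one_le_left (by positivity) ?_
        rw [div_mul_eq_mul_div, one_le_div hd]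
        linarith
      · have hxf : x ∈ frontier ω := by rw [hω.frontier_eq]; exact ⟨hx, hxω⟩
        obtain ⟨ρ, L, C, hρ, hL, hC⟩ := hardy_boundary_chart hω hC2 hxf hb hp
        refine ⟨ball x ρ, mem_nhdsWithin_of_mem_nhds (ball_mem_nhds x hρ),
          C * (((2 : ℝ) ^ |b + 1|).toNNReal + ((2 : ℝ) ^ |b + p|).toNNReal), fun v g h => ?_⟩
        refine wInt_le_of_forall_pos hω hc inter_subset_right fun τ hτ => ?_
        -- Chosen so that the loss `2 * (L * τ')` in the chart estimate is exactly `τ`.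
        set τ' := τ / (2 * L) with hτ'
        have hτ'0 : 0 < τ' := by positivity
        have hττ : 2 * (L * τ') = τ := by rw [hτ']; field_simp
        have H := transfer_smooth (k := 0) (b := b + 1) (a := b + p) (β := b) (q := p)
          (C₁ := 0) (C₂ := C) (C₃ := C) (S := ball x ρ ∩ ω ∩ {y | τ < infDist y ωᶜ})
          hω hbd hc hp h hτ'0 (fun y hy => hy.1.2)
          one_pos (fun u hu => by
            rw [ENNReal.rpow_one, zero_mul, zero_add]
            refine (wInt_mono_set ?_ _ _ _).trans (hC τ' hτ'0 u (hu.of_le (by exact_mod_cast le_top)))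
            rw [hττ]
            exact fun y hy => ⟨hy.1.1, hy.2⟩)
        rw [ENNReal.rpow_one, zero_mul, zero_add] at H
        refine H.trans ?_
        push_cast
        rw [← mul_assoc, ← mul_assoc]
        gcongr
        · exact le_self_add
        · exact le_add_self
  rwa [inter_eq_right.2 subset_closure] at key

lemma exists_wInt_le_mul_wInt (hn : 0 < n) (hω : IsOpen ω) (hbd : Bornology.IsBounded ω)
    {F : Type*} [NormedAddCommGroup F] {β β' : ℝ} (h : β' ≤ β) (q : ℝ) :
    ∃ C : ℝ≥0, ∀ f : EucSp n → F, wInt ω ω β q f ≤ C * wInt ω ω β' q f := by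
  have hc := compl_nonempty_of_isBounded hn hbd
  obtain ⟨D, hD0, hD⟩ := exists_infDist_compl_le hn hbd
  refine ⟨(D ^ (β - β')).toNNReal, fun f =>
    wInt_le_mul_wInt hω.measurableSet (by positivity) (fun x hx => ?_) q f⟩
  have hd := (infDist_compl_pos_iff hω hc).2 hx
  have h3 : infDist x ωᶜ ^ β = infDist x ωᶜ ^ (β - β') * infDist x ωᶜ ^ β' := by
    rw [← Real.rpow_add hd]; congr 1; ring
  rw [h3]
  gcongr
  exact hD x hx

/-- Where `η / 2 < d ≤ D`, all powers of `d` are comparable, so the unweighted Poincaré inequality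
accepts any weights on its right side. -/
lemma wInt_interior_le (hn : 0 < n) (hω : IsOpen ω) (hbd : Bornology.IsBounded ω)
    {p : ℝ} (hp : 1 ≤ p) (a k : ℝ) {η : ℝ} (hη : 0 < η) :
    ∃ C : ℝ≥0, ∀ (v : EucSp n → ℝ) (g : EucSp n → EucSp n), IsSobolevW1 p ω v g →
      wInt ω {x | η < infDist x ωᶜ} 0 p v ≤
        C * (wInt ω ω k 1 v) ^ p + C * wInt ω ω a p g := by
  have hc := compl_nonempty_of_isBounded hn hbd
  have hp0 : 0 ≤ p := by linarith
  obtain ⟨C, hC⟩ := interior_poincare hn hω hbd hp hη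
  obtain ⟨D, hD0, hD⟩ := exists_infDist_compl_le hn hbd
  have hη2 : 0 < η / 2 := by positivity
  obtain ⟨c₁, hc₁, h₁⟩ := exists_rpow_le_mul_rpow (D := D) hη2 0 k
  obtain ⟨c₃, hc₃, h₃⟩ := exists_rpow_le_mul_rpow (D := D) hη2 0 a
  have hUm := measurableSet_lt_infDist ω (η / 2)
  have hsub : ∀ η : ℝ, 0 < η → {x | η < infDist x ωᶜ} ⊆ ω := fun η hη x hx =>
    (infDist_compl_pos_iff hω hc).1 (hη.trans hx)
  have hpt : ∀ {c β : ℝ}, (∀ t, η / 2 ≤ t → t ≤ D → t ^ (0 : ℝ) ≤ c * t ^ β) →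
      ∀ x ∈ {x | η / 2 < infDist x ωᶜ}, infDist x ωᶜ ^ (0 : ℝ) ≤ c * infDist x ωᶜ ^ β :=
    fun h x hx => h _ (le_of_lt hx) (hD x (hsub _ hη2 hx))
  set c₁' := c₁.toNNReal
  set c₃' := c₃.toNNReal
  refine ⟨C * (c₁' ^ p * ((2 : ℝ) ^ |k|).toNNReal ^ p) + C * (c₃' * ((2 : ℝ) ^ |a|).toNNReal),
    fun v g h => ?_⟩
  have H := transfer_smooth (k := k) (b := 0) (a := a) (β := 0) (q := p)
    (C₁ := C * (c₁' : ℝ≥0∞) ^ p) (C₂ := 0) (C₃ := C * c₃') (S := {x | η < infDist x ωᶜ})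
    hω hbd hc hp h hη2 (hsub _ hη) one_pos (fun u hu => by
      have hu1 : ContDiff ℝ 1 u := hu.of_le (by exact_mod_cast le_top)
      rw [ENNReal.rpow_one, zero_mul, add_zero]
      refine (hC u hu1).trans ?_
      rw [mul_assoc, mul_assoc, ← ENNReal.mul_rpow_of_nonneg _ _ hp0]
      gcongr
      · exact wInt_le_mul_wInt hUm hc₁ (hpt h₁) 1 u
      · exact wInt_le_mul_wInt hUm hc₃ (hpt h₃) p _)
  rw [ENNReal.rpow_one, zero_mul, add_zero, ENNReal.mul_rpow_of_nonneg _ _ hp0] at H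
  refine H.trans ?_
  push_cast
  rw [ENNReal.coe_rpow_of_nonneg _ hp0, ENNReal.coe_rpow_of_nonneg _ hp0]
  rw [← mul_assoc, ← mul_assoc]
  gcongr
  · refine le_add_right (le_of_eq ?_)
    rw [mul_assoc]; rfl
  · refine le_add_left (le_of_eq ?_)
    rw [mul_assoc]; rfl

/-- The finiteness that permits absorption: for `b ≥ 0` the weight is bounded. -/
lemma wInt_lt_top (hn : 0 < n) (hω : IsOpen ω) (hbd : Bornology.IsBounded ω) {p b : ℝ}
    (hp : 1 ≤ p) (hb : 0 ≤ b) {v : EucSp n → ℝ}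
    (hv : MemLp v (ENNReal.ofReal p) (volume.restrict ω)) : wInt ω ω b p v < ∞ := by
  have hp0 : 0 < p := by linarith
  obtain ⟨C, hC⟩ := exists_wInt_le_mul_wInt (F := ℝ) hn hω hbd hb p
  refine (hC v).trans_lt (ENNReal.mul_lt_top ENNReal.coe_lt_top ?_)
  have := lintegral_rpow_enorm_lt_top_of_eLpNorm_lt_top (by simpa using hp0)
    ENNReal.ofReal_ne_top hv.2
  rw [ENNReal.toReal_ofReal hp0.le] at this
  simpa [wInt] using this

lemma ENNReal.le_two_mul_of_le_half_add {x y : ℝ≥0∞} (hx : x ≠ ∞) (h : x ≤ 2⁻¹ * x + y) :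
    x ≤ 2 * y := by
  have h2 : (2 : ℝ≥0∞)⁻¹ * x ≠ ∞ := ENNReal.mul_ne_top (by simp) hx
  have h3 : 2⁻¹ * x + 2⁻¹ * x ≤ 2⁻¹ * x + y := by
    rwa [← add_mul, ENNReal.inv_two_add_inv_two, one_mul]
  have h4 : 2⁻¹ * x ≤ y := (ENNReal.add_le_add_iff_left h2).1 h3
  calc x = 2 * (2⁻¹ * x) := by
        rw [← mul_assoc, ENNReal.mul_inv_cancel (by simp) (by simp), one_mul]
    _ ≤ 2 * y := by gcongr

/-- In the gain-one estimate, `d^(b+1) ≤ η * d^b` in the strip `d ≤ η`, and the rest is an interior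
term. A small `η` lets the strip term be absorbed into the finite left side. -/
lemma hardy_of_nonneg (hn : 0 < n) (hω : IsOpen ω) (hbd : Bornology.IsBounded ω)
    (hC2 : IsClassC2 ω) {a b p : ℝ} (k : ℝ) (hb : 0 ≤ b) (hab : a ≤ b + p) (hp : 1 ≤ p) :
    ∃ C : ℝ≥0, ∀ (v : EucSp n → ℝ) (g : EucSp n → EucSp n), IsSobolevW1 p ω v g →
      wInt ω ω b p v ≤ C * (wInt ω ω k 1 v) ^ p + C * wInt ω ω a p g := by
  have hc := compl_nonempty_of_isBounded hn hbd
  obtain ⟨C, hC⟩ := hardy_gain_one hn hω hbd hC2 (b := b) (by linarith) hp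
  obtain ⟨Cg, hCg⟩ := exists_wInt_le_mul_wInt (F := EucSp n) hn hω hbd hab p
  obtain ⟨D, hD0, hD⟩ := exists_infDist_compl_le hn hbd
  -- Makes `C * η ≤ 1 / 2`.
  set η : ℝ := 1 / (2 * (C + 1)) with hη
  have hη0 : 0 < η := by positivity
  obtain ⟨CI, hCI⟩ := wInt_interior_le hn hω hbd hp a k hη0
  have hsub : {x | η < infDist x ωᶜ} ⊆ ω := fun x hx =>
    (infDist_compl_pos_iff hω hc).1 (hη0.trans hx)
  set D' := (D ^ (b + 1)).toNNReal
  refine ⟨2 * (C * (D' * CI)) + 2 * (C * Cg), fun v g h => ?_⟩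
  set K := wInt ω ω k 1 v
  set G := wInt ω ω a p g
  have hsplit : wInt ω ω (b + 1) p v ≤ ENNReal.ofReal η * wInt ω ω b p v +
      D' * wInt ω {x | η < infDist x ωᶜ} 0 p v := by
    have hU : ω ⊆ (ω ∩ {x | infDist x ωᶜ ≤ η}) ∪ {x | η < infDist x ωᶜ} := fun x hx => by
      rcases le_or_gt (infDist x ωᶜ) η with h | h
      · exact Or.inl ⟨hx, h⟩
      · exact Or.inr h
    refine (wInt_mono_set hU _ _ _).trans ((wInt_union_le _ _ _ _ _).trans ?_)
    gcongr
    · refine (wInt_le_mul_wInt (hω.measurableSet.inter (measurableSet_le measurable_infDist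
        measurable_const)) hη0.le (fun x hx => ?_) p v).trans
        (mul_le_mul_right (wInt_mono_set inter_subset_left _ _ _) _)
      have hd := (infDist_compl_pos_iff hω hc).2 hx.1
      rw [Real.rpow_add hd, Real.rpow_one, mul_comm]
      have : infDist x ωᶜ ≤ η := hx.2
      gcongr
    · refine wInt_le_mul_wInt (measurableSet_lt_infDist ω η) (by positivity) (fun x hx => ?_) p v
      rw [Real.rpow_zero, mul_one]
      exact Real.rpow_le_rpow infDist_nonneg (hD x (hsub hx)) (by linarith)
  have hhalf : (C : ℝ≥0∞) * ENNReal.ofReal η ≤ 2⁻¹ := by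
    rw [← ENNReal.ofReal_coe_nnreal, ← ENNReal.ofReal_mul (by positivity),
      show (2 : ℝ≥0∞)⁻¹ = ENNReal.ofReal 2⁻¹ by
        rw [ENNReal.ofReal_inv_of_pos two_pos]; simp]
    refine ENNReal.ofReal_le_ofReal ?_
    rw [hη, mul_one_div, div_le_iff₀ (by positivity)]
    have : (0 : ℝ) ≤ C := C.2
    linarith
  have hmain : wInt ω ω b p v ≤ 2⁻¹ * wInt ω ω b p v +
      (C * (D' * (CI * K ^ p + CI * G)) + C * (Cg * G)) := by
    calc wInt ω ω b p v ≤ C * wInt ω ω (b + 1) p v + C * wInt ω ω (b + p) p g := hC v g h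
      _ ≤ C * (ENNReal.ofReal η * wInt ω ω b p v + D' * (CI * K ^ p + CI * G)) +
          C * (Cg * G) := by
          gcongr
          · exact hsplit.trans (by gcongr; exact hCI v g h)
          · exact hCg g
      _ = C * ENNReal.ofReal η * wInt ω ω b p v +
          (C * (D' * (CI * K ^ p + CI * G)) + C * (Cg * G)) := by ring
      _ ≤ _ := by gcongr
  have hfin := (wInt_lt_top hn hω hbd hp hb h.memLp).ne
  refine (ENNReal.le_two_mul_of_le_half_add hfin hmain).trans ?_
  push_cast
  calc 2 * ((C : ℝ≥0∞) * (D' * (CI * K ^ p + CI * G)) + C * (Cg * G))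
      = 2 * (C * (D' * CI)) * K ^ p + (2 * (C * (D' * CI)) + 2 * (C * Cg)) * G := by ring
    _ ≤ _ := by gcongr; exact le_self_add

/-- The weighted Hardy inequality on a bounded `C²` set. -/
lemma hardy_inequality (hn : 0 < n) (hω : IsOpen ω) (hbd : Bornology.IsBounded ω)
    (hC2 : IsClassC2 ω) {a p : ℝ} (k : ℝ) (hp : 1 ≤ p) (ha : p - 1 < a) :
    ∃ C : ℝ≥0, ∀ (v : EucSp n → ℝ) (g : EucSp n → EucSp n), IsSobolevW1 p ω v g →
      wInt ω ω (a - p) p v ≤ C * (wInt ω ω k 1 v) ^ p + C * wInt ω ω a p g := by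
  -- The exponent `a - p` may be negative, where finiteness is not yet known and nothing can be
  -- absorbed. One gain step raises it to `a - p + 1 > 0`.
  obtain ⟨C, hC⟩ := hardy_gain_one hn hω hbd hC2 (b := a - p) (by linarith) hp
  obtain ⟨C', hC'⟩ := hardy_of_nonneg hn hω hbd hC2 (a := a) (b := a - p + 1) k
    (by linarith) (by linarith) hp
  refine ⟨C * C' + C, fun v g h => ?_⟩
  refine (hC v g h).trans ?_
  rw [sub_add_cancel]
  push_cast
  calc _ ≤ (C : ℝ≥0∞) * (C' * (wInt ω ω k 1 v) ^ p + C' * wInt ω ω a p g) +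
        C * wInt ω ω a p g := by gcongr; exact hC' v g h
    _ = C * C' * (wInt ω ω k 1 v) ^ p + (C * C' + C) * wInt ω ω a p g := by ring
    _ ≤ _ := by gcongr; exact le_self_add

end GlobalHardy

/-! ### The weighted Sobolev inequality -/

section Sobolev

variable {n : ℕ} {ω : Set (EucSp n)}

/-- Mollification of a `1`-Lipschitz function. -/
lemma LipschitzWith.exists_contDiff_approx {E : Type*} [NormedAddCommGroup E]
    [InnerProductSpace ℝ E] [FiniteDimensional ℝ E] [MeasurableSpace E] [BorelSpace E]
    {f : E → ℝ} (hf : LipschitzWith 1 f) {ε : ℝ} (hε : 0 < ε) :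
    ∃ f' : E → ℝ, ContDiff ℝ 1 f' ∧ (∀ x, |f' x - f x| ≤ ε) ∧ ∀ x, ‖fderiv ℝ f' x‖ ≤ 1 := by
  let φ : ContDiffBump (0 : E) := ⟨ε / 2, ε, by positivity, half_lt_self hε⟩
  set ρ := φ.normed volume with hρ
  have hρc : Continuous ρ := φ.continuous_normed
  have hρs : HasCompactSupport ρ := φ.hasCompactSupport_normed
  have hint : ∀ x, Integrable (fun t => ρ t * f (x - t)) := fun x =>
    (hρc.mul (hf.continuous.comp (by fun_prop))).integrable_of_hasCompactSupport hρs.mul_right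
  refine ⟨convolution ρ f (ContinuousLinearMap.lsmul ℝ ℝ) volume,
    hρs.contDiff_convolution_left _ φ.contDiff_normed hf.continuous.locallyIntegrable,
    fun x => ?_, fun x => ?_⟩
  · rw [← Real.dist_eq]
    refine φ.dist_normed_convolution_le hf.continuous.aestronglyMeasurable fun y hy => ?_
    have := hf.dist_le_mul y x
    rw [NNReal.coe_one, one_mul] at this
    exact this.trans (le_of_lt hy)
  · have hl : LipschitzWith 1 (convolution ρ f (ContinuousLinearMap.lsmul ℝ ℝ) volume) := by
      refine LipschitzWith.of_dist_le_mul fun x y => ?_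
      rw [Real.dist_eq, convolution_def, convolution_def]
      simp only [ContinuousLinearMap.lsmul_apply, smul_eq_mul]
      rw [← integral_sub (hint x) (hint y), NNReal.coe_one, one_mul, ← Real.norm_eq_abs]
      calc _ ≤ ∫ t, ρ t * dist x y := by
            refine norm_integral_le_of_norm_le (φ.integrable_normed.mul_const _)
              (Eventually.of_forall fun t => ?_)
            have h1 := hf.dist_le_mul (x - t) (y - t)
            rw [NNReal.coe_one, one_mul, dist_sub_right, Real.dist_eq] at h1
            rw [← mul_sub, norm_mul, Real.norm_of_nonneg (φ.nonneg_normed t), Real.norm_eq_abs]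
            exact mul_le_mul_of_nonneg_left h1 (φ.nonneg_normed t)
        _ = dist x y := by rw [integral_mul_const, φ.integral_normed, one_mul]
    simpa using norm_fderiv_le_of_lipschitz ℝ hl (x₀ := x)

/-- A cutoff version of the weight `dist(·, ωᶜ)^α`. -/
lemma exists_weight_cutoff (hbd : Bornology.IsBounded ω)
    (α : ℝ) : ∃ B : ℝ, 0 < B ∧ ∀ τ, 0 < τ → ∃ φ : EucSp n → ℝ, ContDiff ℝ 1 φ ∧
      HasCompactSupport φ ∧ (∀ x, infDist x ωᶜ ≤ τ → φ x = 0 ∧ fderiv ℝ φ x = 0) ∧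
      (∀ x, τ < infDist x ωᶜ → |φ x| ≤ B * infDist x ωᶜ ^ α ∧
        ‖fderiv ℝ φ x‖ ≤ B * infDist x ωᶜ ^ (α - 1)) ∧
      ∀ x, 5 * τ < infDist x ωᶜ → infDist x ωᶜ ^ α ≤ B * |φ x| := by
  obtain ⟨M, hM0, hM⟩ := exists_mul_deriv_stepFn_le
  set B := 2 ^ |α| + (|α| + M) * 2 ^ |α - 1| with hB
  have h2α : (0 : ℝ) < 2 ^ |α| := by positivity
  have h2α' : 0 ≤ (|α| + M) * 2 ^ |α - 1| := by positivity
  refine ⟨B, by positivity, fun τ hτ => ?_⟩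
  have hτ2 : 0 < 2 * τ := by positivity
  -- With error `τ / 2`, `d ≤ τ` gives `f < 2 * τ`, where the step is 0, and `d > 5 * τ` gives `f >
  -- 4 * τ`, where it is 1. For `d > τ`, `f` and `d` agree up to a factor 2.
  obtain ⟨f, hf, hfd, hfg⟩ := (lipschitz_infDist_pt ωᶜ).exists_contDiff_approx (half_pos hτ)
  set F : ℝ → ℝ := fun t => t ^ α * stepFn (2 * τ) t with hF
  have hFC : ContDiff ℝ 1 F := contDiff_rpow_mul_stepFn hτ2 α
  have hsmall : ∀ x, infDist x ωᶜ ≤ τ → f x < 2 * τ := fun x hx => by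
    have := (abs_le.1 (hfd x)).2; linarith
  have hder : ∀ x, fderiv ℝ (fun x => F (f x)) x = (α * f x ^ (α - 1) * stepFn (2 * τ) (f x) +
      f x ^ α * deriv (stepFn (2 * τ)) (f x)) • fderiv ℝ f x := fun x =>
    ((hasDerivAt_rpow_mul_stepFn hτ2 α (f x)).comp_hasFDerivAt x
        (hf.differentiable one_ne_zero x).hasFDerivAt).fderiv
  refine ⟨fun x => F (f x), hFC.comp hf, ?_, fun x hx => ⟨?_, ?_⟩, fun x hx => ⟨?_, ?_⟩,
    fun x hx => ?_⟩
  · refine HasCompactSupport.intro hbd.isCompact_closure fun x hx => ?_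
    have hxω : x ∈ ωᶜ := fun h => hx (subset_closure h)
    have h0 : infDist x ωᶜ = 0 := infDist_zero_of_mem hxω
    simp only [hF, stepFn_eq_zero hτ2 (hsmall x (h0.trans_le hτ.le)).le, mul_zero]
  · simp only [hF, stepFn_eq_zero hτ2 (hsmall x hx).le, mul_zero]
  · rw [hder, stepFn_eq_zero hτ2 (hsmall x hx).le, deriv_stepFn_eq_zero hτ2 (hsmall x hx)]
    simp
  all_goals
    obtain ⟨h1, h2⟩ := abs_le.1 (hfd x)
    have hd0 : 0 < infDist x ωᶜ := by linarith
    have hf0 : 0 < f x := by linarith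
    have h3 : f x ≤ 2 * infDist x ωᶜ := by linarith
    have h4 : infDist x ωᶜ ≤ 2 * f x := by linarith
    have hs0 := stepFn_nonneg (2 * τ) (f x)
    have hs1 := stepFn_le_one (2 * τ) (f x)
  · simp only [hF]
    rw [abs_of_nonneg (by positivity)]
    calc f x ^ α * stepFn (2 * τ) (f x) ≤ f x ^ α * 1 := by gcongr
      _ ≤ 2 ^ |α| * infDist x ωᶜ ^ α := by
        rw [mul_one]; exact rpow_le_rpow_abs_mul two_pos hf0 hd0 h3 h4 α
      _ ≤ B * infDist x ωᶜ ^ α := by gcongr; linarith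
  · rw [hder, norm_smul]
    have h5 : f x ^ α = f x ^ (α - 1) * f x := by
      conv_rhs => rw [← Real.rpow_one (f x), ← Real.rpow_mul hf0.le, one_mul,
        ← Real.rpow_add hf0]
      congr 1; ring
    have h6 := hM (2 * τ) hτ2 (f x)
    calc _ ≤ (|α| * f x ^ (α - 1) * 1 + f x ^ (α - 1) * M) * 1 := by
          refine mul_le_mul ?_ (hfg x) (norm_nonneg _) (by positivity)
          refine (norm_add_le _ _).trans (add_le_add ?_ ?_)
          · rw [norm_mul, norm_mul, Real.norm_eq_abs, Real.norm_of_nonneg hs0,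
              Real.norm_of_nonneg (Real.rpow_nonneg hf0.le _)]
            gcongr
          · rw [h5, norm_mul, norm_mul, Real.norm_of_nonneg (Real.rpow_nonneg hf0.le _), mul_assoc]
            gcongr
            exact h6
      _ = (|α| + M) * f x ^ (α - 1) := by ring
      _ ≤ (|α| + M) * (2 ^ |α - 1| * infDist x ωᶜ ^ (α - 1)) := by
          gcongr
          exact rpow_le_rpow_abs_mul two_pos hf0 hd0 h3 h4 (α - 1)
      _ ≤ B * infDist x ωᶜ ^ (α - 1) := by
          rw [← mul_assoc]
          gcongr
          linarith
  · simp only [hF]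
    rw [stepFn_eq_one hτ2 (by linarith), mul_one, abs_of_nonneg (by positivity)]
    calc infDist x ωᶜ ^ α ≤ 2 ^ |α| * f x ^ α :=
          rpow_le_rpow_abs_mul two_pos hd0 hf0 h4 h3 α
      _ ≤ B * f x ^ α := by gcongr; linarith

/-- Gagliardo–Nirenberg–Sobolev for `φ * u` with `φ ≈ d^(a/p)`: the power `p*` of this weight is
`d^(na/(n-p))`, while `|φ|^p` and `|∇φ|^p` are bounded by multiples of `d^a` and `d^(a-p)`. -/
lemma sobolev_smooth (hn : 0 < n) (hbd : Bornology.IsBounded ω) {p a : ℝ}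
    (hp : 1 ≤ p) (hpn : p < n) :
    ∃ C : ℝ≥0, ∀ τ, 0 < τ → ∀ u : EucSp n → ℝ, ContDiff ℝ 1 u →
      (wInt ω {x | 5 * τ < infDist x ωᶜ} (n * a / (n - p)) (sobolevExp n p) u) ^
          (p / sobolevExp n p) ≤
        C * wInt ω {x | τ < infDist x ωᶜ} (a - p) p u +
        C * wInt ω {x | τ < infDist x ωᶜ} a p (fderiv ℝ u) := by
  have hc := compl_nonempty_of_isBounded hn hbd
  have hp0 : 0 < p := by linarith
  have hn0 : (0 : ℝ) < n := by exact_mod_cast hn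
  have hnp : 0 < (n : ℝ) - p := by linarith
  set q := sobolevExp n p with hq
  have hqe : q = n * p / (n - p) := rfl
  have hq0 : 0 < q := by rw [hqe]; positivity
  obtain ⟨B, hB0, hB⟩ := exists_weight_cutoff hbd (a / p)
  set S := SNormLESNormFDerivOfEqConst ℝ (volume : Measure (EucSp n)) p.toNNReal with hS
  set B' := B.toNNReal
  have hBB : ENNReal.ofReal B = B' := rfl
  refine ⟨B' ^ p * (S ^ p * (2 ^ p * B' ^ p)), fun τ hτ u hu => ?_⟩
  obtain ⟨φ, hφ, hφc, hφ0, hφu, hφl⟩ := hB τ hτ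
  set U := {x | τ < infDist x ωᶜ} with hU
  have hUm : MeasurableSet U := measurableSet_lt_infDist ω τ
  set w : EucSp n → ℝ := fun x => φ x * u x with hw
  have hwC : ContDiff ℝ 1 w := hφ.mul hu
  have hGNS : eLpNorm w q.toNNReal volume ≤ S * eLpNorm (fderiv ℝ w) p.toNNReal volume := by
    refine eLpNorm_le_eLpNorm_fderiv_of_eq volume hwC hφc.mul_right ?_ ?_ ?_
    · rw [← NNReal.coe_le_coe, Real.coe_toNNReal _ hp0.le]; exact_mod_cast hp
    · rw [finrank_euclideanSpace_fin]; exact hn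
    · rw [finrank_euclideanSpace_fin, NNReal.coe_inv, Real.coe_toNNReal _ hp0.le, Real.coe_toNNReal _ hq0.le, hqe]
      field_simp
  have hL : ∀ {r : ℝ} (hr : 0 < r) {F : Type} [NormedAddCommGroup F] (f : EucSp n → F),
      eLpNorm f r.toNNReal volume = (∫⁻ x, ‖f x‖ₑ ^ r) ^ (1 / r) := by
    intro r hr F _ f
    rw [eLpNorm_eq_lintegral_rpow_enorm_toReal (by simpa using hr) ENNReal.coe_ne_top]
    simp [hr.le]
  rw [hL hq0, hL hp0] at hGNS
  have hGNSp : (∫⁻ x, ‖w x‖ₑ ^ q) ^ (p / q) ≤ (S : ℝ≥0∞) ^ p * ∫⁻ x, ‖fderiv ℝ w x‖ₑ ^ p := by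
    have := ENNReal.rpow_le_rpow hGNS hp0.le
    rw [← ENNReal.rpow_mul, ENNReal.mul_rpow_of_nonneg _ _ hp0.le, ← ENNReal.rpow_mul,
      one_div_mul_cancel hp0.ne', ENNReal.rpow_one, one_div_mul_eq_div] at this
    exact this
  have hlow : wInt ω {x | 5 * τ < infDist x ωᶜ} (n * a / (n - p)) q u ≤
      (B' : ℝ≥0∞) ^ q * ∫⁻ x, ‖w x‖ₑ ^ q := by
    rw [← lintegral_const_mul' _ _ (ENNReal.rpow_ne_top_of_nonneg hq0.le ENNReal.coe_ne_top)]
    refine (setLIntegral_mono' (measurableSet_lt_infDist ω _) fun x hx => ?_).trans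
      (setLIntegral_le_lintegral _ _)
    have hx' : 5 * τ < infDist x ωᶜ := hx
    have hd0 : 0 < infDist x ωᶜ := by linarith
    have h1 : infDist x ωᶜ ^ (n * a / (n - p)) = (infDist x ωᶜ ^ (a / p)) ^ q := by
      rw [← Real.rpow_mul hd0.le, hqe]; congr 1; field_simp
    rw [h1, ← ENNReal.ofReal_rpow_of_nonneg (by positivity) hq0.le, hw, enorm_mul,
      ← ENNReal.mul_rpow_of_nonneg _ _ hq0.le, ← ENNReal.mul_rpow_of_nonneg _ _ hq0.le,
      ← mul_assoc]
    gcongr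
    rw [← hBB, ← ofReal_norm, ← ENNReal.ofReal_mul hB0.le]
    exact ENNReal.ofReal_le_ofReal (hφl x hx')
  have hup : ∫⁻ x, ‖fderiv ℝ w x‖ₑ ^ p ≤ 2 ^ p * (B' : ℝ≥0∞) ^ p *
      (wInt ω U (a - p) p u + wInt ω U a p (fderiv ℝ u)) := by
    have hm : Measurable fun x => ENNReal.ofReal (infDist x ωᶜ ^ (a - p)) * ‖u x‖ₑ ^ p :=
      (measurable_weight ω _).mul (hu.continuous.measurable.enorm.pow_const p)
    have hcst : (2 : ℝ≥0∞) ^ p * (B' : ℝ≥0∞) ^ p ≠ ∞ :=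
      ENNReal.mul_ne_top (ENNReal.rpow_ne_top_of_nonneg hp0.le (by simp))
        (ENNReal.rpow_ne_top_of_nonneg hp0.le ENNReal.coe_ne_top)
    rw [wInt, wInt, ← lintegral_add_left hm, ← lintegral_const_mul' _ _ hcst,
      ← lintegral_indicator hUm]
    refine lintegral_mono fun x => ?_
    have hfd : fderiv ℝ w x = φ x • fderiv ℝ u x + u x • fderiv ℝ φ x :=
      fderiv_fun_mul (hφ.differentiable one_ne_zero x) (hu.differentiable one_ne_zero x)
    by_cases hx : x ∈ U
    · rw [indicator_of_mem hx]
      have hd0 : 0 < infDist x ωᶜ := hτ.trans hx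
      obtain ⟨h1, h2⟩ := hφu x hx
      have e1 : ‖φ x‖ₑ ≤ B' * ENNReal.ofReal (infDist x ωᶜ ^ (a / p)) := by
        rw [← hBB, ← ofReal_norm, ← ENNReal.ofReal_mul hB0.le]
        exact ENNReal.ofReal_le_ofReal h1
      have e2 : ‖fderiv ℝ φ x‖ₑ ≤ B' * ENNReal.ofReal (infDist x ωᶜ ^ (a / p - 1)) := by
        rw [← hBB, ← ofReal_norm, ← ENNReal.ofReal_mul hB0.le]
        exact ENNReal.ofReal_le_ofReal h2
      have e3 : ∀ β γ : ℝ, β * p = γ → (ENNReal.ofReal (infDist x ωᶜ ^ β)) ^ p =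
          ENNReal.ofReal (infDist x ωᶜ ^ γ) := by
        rintro β γ rfl
        rw [ENNReal.ofReal_rpow_of_nonneg (by positivity) hp0.le, ← Real.rpow_mul hd0.le]
      have e4 := e3 (a / p) a (by field_simp)
      have e5 := e3 (a / p - 1) (a - p) (by field_simp)
      calc ‖fderiv ℝ w x‖ₑ ^ p
          ≤ (‖u x‖ₑ * ‖fderiv ℝ φ x‖ₑ + ‖φ x‖ₑ * ‖fderiv ℝ u x‖ₑ) ^ p := by
            gcongr
            rw [hfd, add_comm]
            simp only [← ofReal_norm]
            rw [← ENNReal.ofReal_mul (norm_nonneg _), ← ENNReal.ofReal_mul (norm_nonneg _),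
              ← ENNReal.ofReal_add (by positivity) (by positivity), ← norm_smul, ← norm_smul]
            exact ENNReal.ofReal_le_ofReal (norm_add_le _ _)
        _ ≤ 2 ^ p * ((‖u x‖ₑ * ‖fderiv ℝ φ x‖ₑ) ^ p + (‖φ x‖ₑ * ‖fderiv ℝ u x‖ₑ) ^ p) :=
            ENNReal.add_rpow_le_two_rpow_mul hp0.le _ _
        _ ≤ 2 ^ p * ((‖u x‖ₑ * (B' * ENNReal.ofReal (infDist x ωᶜ ^ (a / p - 1)))) ^ p +
            (B' * ENNReal.ofReal (infDist x ωᶜ ^ (a / p)) * ‖fderiv ℝ u x‖ₑ) ^ p) := by gcongr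
        _ = _ := by
            simp only [ENNReal.mul_rpow_of_nonneg _ _ hp0.le, e4, e5]
            ring
    · have h0 := hφ0 x (not_lt.1 hx)
      rw [indicator_of_notMem hx, hfd, h0.1, h0.2, zero_smul, smul_zero, add_zero, ← ofReal_norm,
        norm_zero, ENNReal.ofReal_zero, ENNReal.zero_rpow_of_pos hp0]
  have hpq : 0 ≤ p / q := by positivity
  calc (wInt ω {x | 5 * τ < infDist x ωᶜ} (n * a / (n - p)) q u) ^ (p / q)
      ≤ ((B' : ℝ≥0∞) ^ q * ∫⁻ x, ‖w x‖ₑ ^ q) ^ (p / q) := by gcongr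
    _ = (B' : ℝ≥0∞) ^ p * (∫⁻ x, ‖w x‖ₑ ^ q) ^ (p / q) := by
        rw [ENNReal.mul_rpow_of_nonneg _ _ hpq, ← ENNReal.rpow_mul, mul_div_cancel₀ _ hq0.ne']
    _ ≤ (B' : ℝ≥0∞) ^ p * ((S : ℝ≥0∞) ^ p * (2 ^ p * (B' : ℝ≥0∞) ^ p *
        (wInt ω U (a - p) p u + wInt ω U a p (fderiv ℝ u)))) := by
        gcongr
        exact hGNSp.trans (by gcongr)
    _ = _ := by
        push_cast
        rw [ENNReal.coe_rpow_of_nonneg _ hp0.le, ENNReal.coe_rpow_of_nonneg _ hp0.le,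
          ENNReal.coe_rpow_of_nonneg _ hp0.le]
        push_cast
        ring

/-- The weighted Sobolev inequality, with the Hardy term on the right. -/
lemma sobolev_hardy_inequality (hn : 0 < n) (hω : IsOpen ω) (hbd : Bornology.IsBounded ω)
    {p a : ℝ} (hp : 1 ≤ p) (hpn : p < n) :
    ∃ C : ℝ≥0, ∀ (v : EucSp n → ℝ) (g : EucSp n → EucSp n), IsSobolevW1 p ω v g →
      (wInt ω ω (n * a / (n - p)) (sobolevExp n p) v) ^ (p / sobolevExp n p) ≤
        C * wInt ω ω (a - p) p v + C * wInt ω ω a p g := by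
  have hc := compl_nonempty_of_isBounded hn hbd
  have hp0 : 0 < p := by linarith
  have hn0 : (0 : ℝ) < n := by exact_mod_cast hn
  have hnp : 0 < (n : ℝ) - p := by linarith
  have hq0 : 0 < sobolevExp n p := by rw [sobolevExp]; positivity
  have hθ : 0 < p / sobolevExp n p := by positivity
  obtain ⟨C, hC⟩ := sobolev_smooth (a := a) hn hbd hp hpn
  refine ⟨C * (((2 : ℝ) ^ |a - p|).toNNReal + ((2 : ℝ) ^ |a|).toNNReal), fun v g h => ?_⟩
  rw [← ENNReal.le_rpow_inv_iff hθ]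
  refine wInt_le_of_forall_pos hω hc subset_rfl fun τ hτ => ?_
  rw [ENNReal.le_rpow_inv_iff hθ]
  have H := transfer_smooth (k := 0) (b := a - p) (a := a) (β := n * a / (n - p))
    (q := sobolevExp n p) (C₁ := 0) (C₂ := C) (C₃ := C) (S := ω ∩ {y | τ < infDist y ωᶜ})
    hω hbd hc hp h (τ := τ / 5) (by positivity) inter_subset_left hθ (fun u hu => by
      rw [zero_mul, zero_add]
      refine (ENNReal.rpow_le_rpow (wInt_mono_set ?_ _ _ _) hθ.le).trans
        (hC (τ / 5) (by positivity) u (hu.of_le (by exact_mod_cast le_top)))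
      rw [mul_div_cancel₀ _ (by norm_num : (5 : ℝ) ≠ 0)]
      exact inter_subset_right)
  rw [zero_mul, zero_add] at H
  refine H.trans ?_
  push_cast
  rw [← mul_assoc, ← mul_assoc]
  gcongr
  · exact le_self_add
  · exact le_add_self

lemma lintegral_bdryDist_eq_wInt (hω : IsOpen ω) (hf : ω.Nonempty → (frontier ω).Nonempty)
    {F : Type*} [NormedAddCommGroup F] (β : ℝ) {q : ℝ} (hq : 0 ≤ q) (f : EucSp n → F) :
    ∫⁻ x in ω, ENNReal.ofReal (bdryDist ω x ^ β * ‖f x‖ ^ q) = wInt ω ω β q f := by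
  refine setLIntegral_congr_fun hω.measurableSet fun x hx => ?_
  rw [bdryDist, infDist_frontier_eq hω (hf ⟨x, hx⟩) hx,
    ENNReal.ofReal_mul (Real.rpow_nonneg infDist_nonneg _), ← ofReal_norm,
    ENNReal.ofReal_rpow_of_nonneg (norm_nonneg _) hq]

end Sobolev

/-! ### Assembly: (ii) is the Hardy inequality, and (i) follows by inserting it into the Sobolev
inequality -/

theorem proposition2 (n : ℕ) (hn : 2 ≤ n) (ω : Set (EucSp n)) (hopen : IsOpen ω)
    (hbdd : Bornology.IsBounded ω) (hC2 : IsClassC2 ω)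
    (p a k : ℝ) (hp1 : 1 ≤ p) (hpn : p < n) (ha : p - 1 < a) (hk : 0 ≤ k) :
    (∃ C : ℝ≥0, ∀ (v : EucSp n → ℝ) (g : EucSp n → EucSp n), IsSobolevW1 p ω v g →
      (∫⁻ x in ω, ENNReal.ofReal
          (bdryDist ω x ^ ((n : ℝ) * a / ((n : ℝ) - p)) * |v x| ^ sobolevExp n p))
            ^ (p / sobolevExp n p)
        ≤ C * (∫⁻ x in ω, ENNReal.ofReal (bdryDist ω x ^ k * |v x|)) ^ p
          + C * ∫⁻ x in ω, ENNReal.ofReal (bdryDist ω x ^ a * ‖g x‖ ^ p)) ∧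
    (∃ C : ℝ≥0, ∀ (v : EucSp n → ℝ) (g : EucSp n → EucSp n), IsSobolevW1 p ω v g →
      ∫⁻ x in ω, ENNReal.ofReal (bdryDist ω x ^ (a - p) * |v x| ^ p)
        ≤ C * (∫⁻ x in ω, ENNReal.ofReal (bdryDist ω x ^ k * |v x|)) ^ p
          + C * ∫⁻ x in ω, ENNReal.ofReal (bdryDist ω x ^ a * ‖g x‖ ^ p)) := by
  have hn0 : 0 < n := by omega
  have hp0 : 0 ≤ p := by linarith
  have hq0 : 0 ≤ sobolevExp n p := by
    have : 0 < (n : ℝ) - p := by linarith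
    rw [sobolevExp]; positivity
  have hf := frontier_nonempty_of_isBounded hn0 hbdd
  have conv := fun (β : ℝ) {q : ℝ} (hq : 0 ≤ q) (v : EucSp n → ℝ) =>
    lintegral_bdryDist_eq_wInt hopen hf β hq v
  have conv₁ : ∀ v : EucSp n → ℝ, ∫⁻ x in ω, ENNReal.ofReal (bdryDist ω x ^ k * |v x|) =
      wInt ω ω k 1 v := fun v => by simpa using conv k zero_le_one v
  simp only [Real.norm_eq_abs] at conv
  obtain ⟨C, hC⟩ := hardy_inequality hn0 hopen hbdd hC2 k hp1 ha
  obtain ⟨C', hC'⟩ := sobolev_hardy_inequality (a := a) hn0 hopen hbdd hp1 hpn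
  refine ⟨⟨C' * C + C', fun v g h => ?_⟩, ⟨C, fun v g h => ?_⟩⟩
  · rw [conv _ hq0, conv₁, lintegral_bdryDist_eq_wInt hopen hf a hp0 g]
    refine (hC' v g h).trans ?_
    push_cast
    calc _ ≤ (C' : ℝ≥0∞) * (C * (wInt ω ω k 1 v) ^ p + C * wInt ω ω a p g) +
          C' * wInt ω ω a p g := by gcongr; exact hC v g h
      _ = C' * C * (wInt ω ω k 1 v) ^ p + (C' * C + C') * wInt ω ω a p g := by ring
      _ ≤ _ := by gcongr; exact le_self_add
  · rw [conv _ hp0, conv₁, lintegral_bdryDist_eq_wInt hopen hf a hp0 g]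
    exact hC v g h
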